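/- Theorem 1. Let $f:(0,\infty)\to\mathbb R$ be a locally integrable function whose Laplace transform $F(z)=\int_0^\infty e^{-zt}f(t)\,dt$ exists (as a Lebesgue integral) for all $z>0$. For $n\ge 1$ and $x>0$ define the Gaver–Stehfest approximations $$f_n(x)=\frac{\ln 2}{x}\sum_{k=1}^{2n}a_k(n)\,F\!\left(\frac{k\ln 2}{x}\right),\qquad a_k(n)=\frac{(-1)^{n+k}}{n!}\sum_{j=\lfloor (k+1)/2\rfloor}^{\min(k,n)}j^{n+1}\binom nj\binom{2j}{j}\binom{j}{k-j}.$$ Fix $x>0$. (i) The convergence of $f_n(x)$ depends only on the values of $f$ in a neighborhood of $x$: if $g:(0,\infty)\to\mathbb R$ satisfies the same assumptions as $f$, and $g=f$ on some neighborhood of $x$, then for every $c\in\mathbb R$ we have $f_n(x)\to c$ as $n\to\infty$ if and only if $g_n(x)\to c$ as $n\to\infty$, where $g_n$ are the Gaver–Stehfest approximations of $g$. (ii) If for some $c\in\mathbb R$ and some $\epsilon\in(0,1/4)$ $$\int_0^{\epsilon}\Big|f\big(-x\log_2(\tfrac12+v)\big)+f\big(-x\log_2(\tfrac12-v)\big)-2c\Big|\,v^{-1}\,dv<\infty,$$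 then $f_n(x)\to c$ as $n\to\infty$. (iii) If $f$ has bounded variation in a neighborhood of $x$, then the one-sided limits $f(x+0)$ and $f(x-0)$ exist and $f_n(x)\to\frac12\big(f(x+0)+f(x-0)\big)$ as $n\to\infty$. -/

import Mathlib

open MeasureTheory Set Filter Topology

namespace GaverStehfest

/-- The Laplace transform `F(z) = ∫_0^∞ e^{-zt} f(t) dt`. Only the values of `f` on `(0,∞)` matter. -/
noncomputable def laplace (f : ℝ → ℝ) (z : ℝ) : ℝ :=
  ∫ t in Ioi (0 : ℝ), Real.exp (-z * t) * f t

/-- The standing assumptions on `f : (0,∞) → ℝ`: it is locally integrable on `(0,∞)`, and the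
(Lebesgue) integral defining its Laplace transform exists for every `z > 0`. -/
structure Admissible (f : ℝ → ℝ) : Prop where
  locallyIntegrable : LocallyIntegrableOn f (Ioi (0 : ℝ))
  laplace_exists : ∀ z : ℝ, 0 < z →
    IntegrableOn (fun t : ℝ => Real.exp (-z * t) * f t) (Ioi (0 : ℝ))

/-- The Gaver–Stehfest coefficients
`a_k(n) = (-1)^(n+k) / n! * ∑_{j=⌊(k+1)/2⌋}^{min(k,n)} j^(n+1) C(n,j) C(2j,j) C(j,k-j)`
(the division by `2` is that of natural numbers, and `j ≤ k` in the sum). -/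
noncomputable def coeff (n k : ℕ) : ℝ :=
  (-1 : ℝ) ^ (n + k) / (n.factorial : ℝ) *
    ∑ j ∈ Finset.Icc ((k + 1) / 2) (min k n),
      (j : ℝ) ^ (n + 1) * (n.choose j : ℝ) * ((2 * j).choose j : ℝ) * (j.choose (k - j) : ℝ)

/-- The Gaver–Stehfest approximations
`f_n(x) = (ln 2 / x) * ∑_{k=1}^{2n} a_k(n) F(k ln 2 / x)`, computed from the Laplace transform
of `f`. -/
noncomputable def approx (f : ℝ → ℝ) (n : ℕ) (x : ℝ) : ℝ :=
  Real.log 2 / x *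
    ∑ k ∈ Finset.Icc 1 (2 * n), coeff n k * laplace f ((k : ℝ) * (Real.log 2 / x))

end GaverStehfest

namespace GaverStehfest

/-! The substitution `1/2 + v = 2^(-t/x)` turns the samples `F(k ln 2 / x)` into power moments on
`(-1/2, 1/2)`, and the point `t = x` into `v = 0`. Summed against the coefficients they give a
kernel `kern n`, a polynomial in `1/4 - v^2` and hence even, so the approximation is the integral of
a folded function against `kern n` over `(0, 1/2)` (`sum_coeff_mul_pow`, `approx_eq_integral_fold`).
The theorem thus asks for analogues of the classical criteria for pointwise convergence of Fourier
series.

Put `exp(-y^2) = 1 - 4 v^2` and replace `C(2j,j)/4^j` by `(πj)^(-1/2)`. The main part of the kernel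
is then a multiple of `∑ w_j √j exp(-j y^2)`, with the alternating weights `w_j = weight n j`. These
weights are the partial fraction coefficients of `∏_{i ≤ n} 1/(1 + i b)`, the Laplace transform of
`∑ i E_i` for independent standard exponential `E_i`. Hence the sum is an average of the
Dirichlet-type kernels `sin(2ky)/y` over a genuine probability density in `k` (`hypoexp_nonneg`,
`sum_weight_mul_sqrt_mul_exp`). As `n → ∞` the product tends to `0`, so the mass of this density
escapes to infinity, and averages of bounded functions of `k` vanishing at infinity tend to `0`
(`tendsto_integral_freqDensity_mul`).

The error in replacing the central binomial coefficient, multiplied by `j`, is the Laplace transform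
of an integrable function (`mul_centralBinom_div_sub_sqrt`). Averaging the Bessel function `J₀` over
the same density shows that its contribution to the kernel is uniformly bounded and tends to `0`
pointwise (`abs_kernError_le`, `tendsto_kernError`).

It therefore suffices that the sine transform of the function integrated against the kernel be
bounded and vanish at infinity (`Negligible.tendsto_integral`). Dini's condition gives this by
Riemann–Lebesgue (`negligible_of_integrableOn_div`), Jordan's by a layer-cake decomposition
(`negligible_of_monotone`). Away from `v = 0` Dini's condition is automatic, except near `v = 1/2`,
where the kernel is estimated directly (`abs_kern_le`). Constants are reproduced exactly
(`approx_const`), which reduces a limit `c` to the limit `0`. -/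

/-! ### The Stehfest weights as partial fraction coefficients -/

/-- The weights `(-1)^(n+j) j^n / (j! (n-j)!)` with which the Stehfest acceleration combines the
Gaver functionals. -/
noncomputable def weight (n j : ℕ) : ℝ :=
  (-1 : ℝ) ^ (n + j) * (j : ℝ) ^ n * (n.choose j : ℝ) / (n.factorial : ℝ)

/-- The source of both moment identities: an `n`-th difference sends `r^n` to `n!` and kills lower
powers. -/
theorem sum_Icc_neg_one_pow_mul_choose (n m : ℕ) (hm : 1 ≤ m) :
    ∑ j ∈ Finset.Icc 1 n, (-1 : ℝ) ^ (n + j) * (n.choose j : ℝ) * (j : ℝ) ^ m =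
      ((fwdDiff (1 : ℝ))^[n] fun r : ℝ => r ^ m) 0 := by
  rw [fwdDiff_iter_eq_sum_shift, Finset.range_eq_Ico, Finset.sum_eq_sum_Ico_succ_bot (by omega)]
  have h0 : m ≠ 0 := by omega
  -- The finite difference also has a `j = 0` term; it vanishes only because `m ≠ 0`.
  simp only [zero_smul, add_zero, zero_pow h0, smul_zero, zero_add]
  apply Finset.sum_congr (by ext; simp)
  intro j hj
  have hj' : j ≤ n := by simp at hj; omega
  obtain ⟨d, rfl⟩ := Nat.exists_eq_add_of_le hj'
  simp only [zsmul_eq_mul, nsmul_eq_mul, mul_one]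
  push_cast
  rw [Nat.add_sub_cancel_left, show j + d + j = d + 2 * j by ring, pow_add, pow_mul]
  simp

theorem sum_weight {n : ℕ} (hn : 1 ≤ n) : ∑ j ∈ Finset.Icc 1 n, weight n j = 1 := by
  have h := sum_Icc_neg_one_pow_mul_choose n n hn
  rw [fwdDiff_iter_eq_factorial] at h
  have hf : (n.factorial : ℝ) ≠ 0 := by positivity
  have : ∑ j ∈ Finset.Icc 1 n, weight n j = (n.factorial : ℝ) / n.factorial := by
    rw [eq_div_iff hf, Finset.sum_mul]
    simp only [Pi.natCast_apply] at h
    refine Eq.trans (Finset.sum_congr rfl fun j _ => ?_) h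
    unfold weight
    field_simp
  rw [this, div_self hf]

/-- Here the exponent drops to `n - 1`, which is positive because `n ≥ 2`. Its meaning is that the
density `hypoexp n` vanishes at `0`. -/
theorem sum_weight_div {n : ℕ} (hn : 2 ≤ n) : ∑ j ∈ Finset.Icc 1 n, weight n j / j = 0 := by
  have h := sum_Icc_neg_one_pow_mul_choose n (n - 1) (by omega)
  rw [fwdDiff_iter_pow_eq_zero_of_lt (by omega)] at h
  have hf : (n.factorial : ℝ) ≠ 0 := by positivity
  have : ∑ j ∈ Finset.Icc 1 n, weight n j / j = 0 / n.factorial := by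
    rw [eq_div_iff hf, Finset.sum_mul]
    simp only [Pi.zero_apply] at h
    rw [← h]
    refine Finset.sum_congr rfl fun j hj => ?_
    have hj' : (j : ℝ) ≠ 0 := by simp at hj; simp; omega
    unfold weight
    obtain ⟨m, rfl⟩ : ∃ m, n = m + 1 := ⟨n - 1, by omega⟩
    rw [Nat.add_sub_cancel, pow_succ (j : ℝ) m]
    field_simp
  rw [this, zero_div]

/-- A new factor `1/(1 + (n+1) b)` multiplies the partial fraction coefficient at `b = -1/j` by its
value there, `1/(1 - (n+1)/j)`. -/
theorem weight_succ_mul {n j : ℕ} (hj : j ≤ n) :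
    weight (n + 1) j * ((j : ℝ) - (n + 1)) = weight n j * j := by
  unfold weight
  have h : ((n + 1).choose j : ℝ) * ((n : ℝ) + 1 - j) = (n.choose j : ℝ) * (n + 1) := by
    have := Nat.choose_mul_succ_eq n j
    have h2 : ((n.choose j * (n + 1) : ℕ) : ℝ) = (((n + 1).choose j * (n + 1 - j) : ℕ) : ℝ) := by
      rw [this]
    rw [Nat.cast_mul, Nat.cast_mul, Nat.cast_sub (by omega)] at h2
    push_cast at h2
    linarith
  have hf : (n.factorial : ℝ) ≠ 0 := by positivity
  rw [Nat.factorial_succ, Nat.cast_mul, div_mul_eq_mul_div, div_mul_eq_mul_div,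
    div_eq_div_iff (by positivity) hf]
  push_cast
  rw [show n + 1 + j = (n + j) + 1 by ring, pow_succ, pow_succ (j : ℝ) n]
  linear_combination (-1 : ℝ) ^ (n + j) * (j : ℝ) ^ n * j * n.factorial * h

theorem weight_eq_zero_of_lt {n j : ℕ} (hj : n < j) : weight n j = 0 := by
  simp [weight, Nat.choose_eq_zero_of_lt hj]

theorem weight_succ_mul' {n j : ℕ} (hj : j ∈ Finset.Icc 1 (n + 1)) :
    weight (n + 1) j * (1 - (n + 1) / (j : ℝ)) = weight n j := by
  rw [Finset.mem_Icc] at hj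
  have hj0 : (j : ℝ) ≠ 0 := by simp; omega
  rcases Nat.lt_or_ge n j with h | h
  · have : j = n + 1 := by omega
    subst this
    rw [weight_eq_zero_of_lt h]
    push_cast at hj0 ⊢
    rw [div_self hj0]; ring
  · have := weight_succ_mul h
    field_simp
    linarith

theorem sum_weight_succ (n : ℕ) (F : ℕ → ℝ) :
    ∑ j ∈ Finset.Icc 1 (n + 1), weight n j * F j = ∑ j ∈ Finset.Icc 1 n, weight n j * F j := by
  rw [Finset.sum_Icc_succ_top (by omega), weight_eq_zero_of_lt (by omega)]
  simp

/-! ### Positivity and Laplace transform of the hypoexponential density -/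

/-- The density of `∑ i ≤ n, i Eᵢ` for independent standard exponential variables `Eᵢ`. -/
noncomputable def hypoexp (n : ℕ) (x : ℝ) : ℝ :=
  ∑ j ∈ Finset.Icc 1 n, weight n j * ((j : ℝ)⁻¹ * Real.exp (-x / j))

/-- Differential form of the convolution with an exponential law of mean `n + 1`. It makes
positivity inductive, although the signs in `hypoexp` alternate. -/
theorem hasDerivAt_exp_mul_hypoexp_succ (n : ℕ) (x : ℝ) :
    HasDerivAt (fun x => Real.exp (x / (n + 1)) * hypoexp (n + 1) x)
      (Real.exp (x / (n + 1)) * hypoexp n x / (n + 1)) x := by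
  have h1 : HasDerivAt (fun x : ℝ => Real.exp (x / (n + 1)))
      (Real.exp (x / (n + 1)) * (1 / (n + 1))) x := ((hasDerivAt_id x).div_const _).exp
  have h2 : HasDerivAt (hypoexp (n + 1))
      (∑ j ∈ Finset.Icc 1 (n + 1),
        weight (n + 1) j * ((j : ℝ)⁻¹ * (Real.exp (-x / j) * (-1 / j)))) x := by
    unfold hypoexp
    apply HasDerivAt.fun_sum
    intro j _
    exact ((((hasDerivAt_id x).neg.div_const _).exp).const_mul _).const_mul _
  refine (h1.mul h2).congr_deriv ?_
  have h3 : hypoexp n x = ∑ j ∈ Finset.Icc 1 (n + 1),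
      weight n j * ((j : ℝ)⁻¹ * Real.exp (-x / j)) := (sum_weight_succ n _).symm
  rw [h3]
  unfold hypoexp
  rw [mul_assoc, ← mul_add, mul_div_assoc]
  congr 1
  rw [Finset.mul_sum, ← Finset.sum_add_distrib, Finset.sum_div]
  refine Finset.sum_congr rfl fun j hj => ?_
  rw [← weight_succ_mul' hj]
  have hj0 : (j : ℝ) ≠ 0 := by simp at hj; simp; omega
  field_simp
  ring

theorem hypoexp_nonneg {n : ℕ} (hn : 1 ≤ n) {x : ℝ} (hx : 0 ≤ x) : 0 ≤ hypoexp n x := by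
  induction n, hn using Nat.le_induction generalizing x with
  | base => simp [hypoexp, weight]; positivity
  | succ n hn ih =>
    have hmono : MonotoneOn (fun x => Real.exp (x / (n + 1)) * hypoexp (n + 1) x) (Ici 0) := by
      apply monotoneOn_of_deriv_nonneg (convex_Ici 0)
      · exact fun x _ => (hasDerivAt_exp_mul_hypoexp_succ n x).continuousAt.continuousWithinAt
      · exact fun x _ => (hasDerivAt_exp_mul_hypoexp_succ n x).differentiableAt.differentiableWithinAt
      · intro x hx
        rw [interior_Ici] at hx
        rw [(hasDerivAt_exp_mul_hypoexp_succ n x).deriv]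
        have := ih hx.le
        positivity
    have h := hmono (mem_Ici.2 le_rfl) hx hx
    -- The nondecreasing function starts from `0`, by the moment identity for `w_j / j`.
    have h0 : hypoexp (n + 1) 0 = 0 := by
      refine Eq.trans ?_ (sum_weight_div (n := n + 1) (by omega))
      simp [hypoexp, div_eq_mul_inv]
    simp only [h0, mul_zero] at h
    exact nonneg_of_mul_nonneg_right h (Real.exp_pos _)

/-- The Laplace transform of `hypoexp n`. -/
theorem sum_weight_div_one_add_succ {n : ℕ} (hn : 1 ≤ n) {b : ℝ} (hb : 0 ≤ b) :
    (∑ j ∈ Finset.Icc 1 (n + 1), weight (n + 1) j / (1 + b * j)) * (1 + (n + 1) * b) =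
      ∑ j ∈ Finset.Icc 1 n, weight n j / (1 + b * j) := by
  have h0 := sum_weight_div (n := n + 1) (by omega)
  have h3 := sum_weight_succ n (fun j => 1 / (1 + b * j))
  simp only [mul_one_div] at h3
  rw [← h3, Finset.sum_mul]
  -- Adding `n + 1` times the vanishing sum of `w_j / j` makes the identity hold term by term.
  have : ∑ j ∈ Finset.Icc 1 (n + 1), weight n j / (1 + b * j) =
      ∑ j ∈ Finset.Icc 1 (n + 1), (weight n j / (1 + b * j)
        + (n + 1) * (weight (n + 1) j / j)) := by
    rw [Finset.sum_add_distrib, ← Finset.mul_sum, h0]; ring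
  rw [this]
  refine Finset.sum_congr rfl fun j hj => ?_
  rw [← weight_succ_mul' hj]
  have hj0 : (j : ℝ) ≠ 0 := by simp at hj; simp; omega
  have : 1 + b * j ≠ 0 := by positivity
  field_simp
  ring

theorem tendsto_sum_weight_div_one_add {b : ℝ} (hb : 0 < b) :
    Tendsto (fun n : ℕ => ∑ j ∈ Finset.Icc 1 n, weight n j / (1 + b * j)) atTop (𝓝 0) := by
  set l : ℕ → ℝ := fun n => ∑ j ∈ Finset.Icc 1 n, weight n j / (1 + b * j) with hl
  have hrec : ∀ n, 1 ≤ n → l (n + 1) = l n / (1 + (n + 1) * b) := by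
    intro n hn
    rw [eq_div_iff (by positivity)]
    exact sum_weight_div_one_add_succ hn hb.le
  have hbd : ∀ n, 1 ≤ n → 0 ≤ l n ∧ l n ≤ 1 := by
    intro n hn
    induction n, hn using Nat.le_induction with
    | base =>
      simp only [hl, weight, Finset.Icc_self, Finset.sum_singleton]
      norm_num
      constructor
      · positivity
      · exact inv_le_one_of_one_le₀ (by linarith)
    | succ n hn ih =>
      rw [hrec n hn]
      refine ⟨div_nonneg ih.1 (by positivity), ?_⟩
      rw [div_le_one (by positivity)]
      have : 0 ≤ ((n : ℝ) + 1) * b := by positivity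
      linarith [ih.2]
  have hup : ∀ n, 1 ≤ n → l (n + 1) ≤ 1 / (1 + (n + 1) * b) := by
    intro n hn
    rw [hrec n hn]
    gcongr
    exact (hbd n hn).2
  rw [← tendsto_add_atTop_iff_nat 1]
  refine tendsto_of_tendsto_of_tendsto_of_le_of_le' tendsto_const_nhds ?_
    (eventually_atTop.2 ⟨1, fun n hn => (hbd (n + 1) (by omega)).1⟩)
    (eventually_atTop.2 ⟨1, hup⟩)
  have h1 : Tendsto (fun n : ℕ => 1 + ((n : ℝ) + 1) * b) atTop atTop := by
    apply tendsto_atTop_add_const_left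
    exact (tendsto_atTop_add_const_right _ _ tendsto_natCast_atTop_atTop).atTop_mul_const hb
  simpa using! h1.inv_tendsto_atTop

/-! ### Gaussian integrals and the Bessel function -/

theorem integral_Ioi_mul_exp_neg_mul_sq {B : ℝ} (hB : 0 < B) :
    ∫ k in Ioi (0 : ℝ), k * Real.exp (-B * k ^ 2) = (2 * B)⁻¹ := by
  have h := integral_mul_cexp_neg_mul_sq (b := (B : ℂ)) (by simpa using hB)
  have h2 : ∀ r : ℝ, (r : ℂ) * Complex.exp (-(B : ℂ) * (r : ℂ) ^ 2) =
      ((r * Real.exp (-B * r ^ 2) : ℝ) : ℂ) := by intro r; push_cast; rfl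
  simp_rw [h2] at h
  rw [integral_complex_ofReal] at h
  exact_mod_cast h

theorem integral_cos_mul_exp_neg_mul_sq {B : ℝ} (hB : 0 < B) (t : ℝ) :
    ∫ k : ℝ, Real.cos (t * k) * Real.exp (-B * k ^ 2) =
      Real.sqrt (Real.pi / B) * Real.exp (-t ^ 2 / (4 * B)) := by
  have h := fourierIntegral_gaussian (b := (B : ℂ)) (by simpa using hB) (t : ℂ)
  have hint : Integrable (fun x : ℝ => Complex.exp (Complex.I * t * x) *
      Complex.exp (-(B : ℂ) * (x : ℂ) ^ 2)) := by
    have h3 := (integrable_exp_neg_mul_sq hB).norm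
    refine Integrable.mono' h3 (by fun_prop) (ae_of_all _ fun x => ?_)
    rw [norm_mul, Complex.norm_exp, Complex.norm_exp]
    have e1 : (Complex.I * t * x).re = 0 := by simp
    have e2 : (-(B : ℂ) * (x : ℂ) ^ 2).re = -B * x ^ 2 := by
      have : (-(B : ℂ) * (x : ℂ) ^ 2) = ((-B * x ^ 2 : ℝ) : ℂ) := by push_cast; rfl
      rw [this, Complex.ofReal_re]
    rw [e1, e2]
    simp
  have h1 := congrArg Complex.re h
  rw [show (∫ (x : ℝ), Complex.exp (Complex.I * t * x) * Complex.exp (-(B : ℂ) * (x : ℂ) ^ 2)).re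
    = ∫ (x : ℝ), (Complex.exp (Complex.I * t * x) * Complex.exp (-(B : ℂ) * (x : ℂ) ^ 2)).re from
    (integral_re hint).symm] at h1
  have h2 : ∀ x : ℝ, (Complex.exp (Complex.I * t * x) * Complex.exp (-(B : ℂ) * (x : ℂ) ^ 2)).re
      = Real.cos (t * x) * Real.exp (-B * x ^ 2) := by
    intro x
    have e2 : Complex.exp (-(B : ℂ) * (x : ℂ) ^ 2) = ((Real.exp (-B * x ^ 2) : ℝ) : ℂ) := by
      push_cast; rfl
    have e1 : Complex.I * t * x = ((t * x : ℝ) : ℂ) * Complex.I := by push_cast; ring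
    rw [e2, Complex.re_mul_ofReal, e1, Complex.exp_ofReal_mul_I_re]
  simp_rw [h2] at h1
  rw [h1]
  have e3 : ((Real.pi : ℂ) / B) ^ (1 / 2 : ℂ) = ((Real.sqrt (Real.pi / B) : ℝ) : ℂ) := by
    rw [Real.sqrt_eq_rpow, Complex.ofReal_cpow (by positivity)]
    push_cast; rfl
  have e4 : Complex.exp (-(t : ℂ) ^ 2 / (4 * B)) = ((Real.exp (-t ^ 2 / (4 * B)) : ℝ) : ℂ) := by
    push_cast; rfl
  rw [e3, e4, ← Complex.ofReal_mul, Complex.ofReal_re]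

theorem integrable_mul_sin_mul_exp_neg_mul_sq {B : ℝ} (hB : 0 < B) (t : ℝ) :
    Integrable fun k : ℝ => k * Real.sin (t * k) * Real.exp (-B * k ^ 2) := by
  refine (integrable_mul_exp_neg_mul_sq hB).norm.mono' (by fun_prop) (ae_of_all _ fun k => ?_)
  simp only [norm_mul, Real.norm_eq_abs]
  have := Real.abs_sin_le_one (t * k)
  have h0 : 0 ≤ |k| := abs_nonneg k
  exact mul_le_mul_of_nonneg_right (mul_le_of_le_one_right h0 this) (abs_nonneg _)

/-- Integrating the derivative of `sin(tk) exp(-Bk^2)` over the line gives `0`, which reduces the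
claim to the cosine integral. -/
theorem integral_mul_sin_mul_exp_neg_mul_sq {B : ℝ} (hB : 0 < B) (t : ℝ) :
    ∫ k : ℝ, k * Real.sin (t * k) * Real.exp (-B * k ^ 2) =
      t / (2 * B) * (Real.sqrt (Real.pi / B) * Real.exp (-t ^ 2 / (4 * B))) := by
  have hc : Integrable fun k : ℝ => Real.cos (t * k) * Real.exp (-B * k ^ 2) := by
    refine (integrable_exp_neg_mul_sq hB).mono' (by fun_prop) (ae_of_all _ fun k => ?_)
    rw [norm_mul, Real.norm_eq_abs, Real.norm_eq_abs, Real.abs_exp]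
    exact mul_le_of_le_one_left (Real.exp_pos _).le (Real.abs_cos_le_one _)
  have hs := integrable_mul_sin_mul_exp_neg_mul_sq hB t
  have hd : ∀ k : ℝ, HasDerivAt (fun k : ℝ => Real.sin (t * k) * Real.exp (-B * k ^ 2))
      (t * (Real.cos (t * k) * Real.exp (-B * k ^ 2)) -
        2 * B * (k * Real.sin (t * k) * Real.exp (-B * k ^ 2))) k := by
    intro k
    have h1 : HasDerivAt (fun k : ℝ => Real.sin (t * k)) (Real.cos (t * k) * (t * 1)) k :=
      ((hasDerivAt_id k).const_mul t).sin
    have h2 : HasDerivAt (fun k : ℝ => Real.exp (-B * k ^ 2))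
        (Real.exp (-B * k ^ 2) * (-B * (2 * k ^ 1))) k := by
      simpa using! (((hasDerivAt_pow 2 k).const_mul (-B)).exp)
    exact (h1.mul h2).congr_deriv (by ring)
  have hlim : ∀ l : Filter ℝ, Tendsto (fun k : ℝ => k ^ 2) l atTop →
      Tendsto (fun k : ℝ => Real.sin (t * k) * Real.exp (-B * k ^ 2)) l (𝓝 0) := by
    intro l hl
    have h1 : Tendsto (fun k : ℝ => Real.exp (-B * k ^ 2)) l (𝓝 0) :=
      Real.tendsto_exp_atBot.comp (hl.const_mul_atTop_of_neg (by linarith))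
    refine squeeze_zero_norm (fun k => ?_) h1
    rw [norm_mul, Real.norm_eq_abs, Real.norm_eq_abs, Real.abs_exp]
    exact mul_le_of_le_one_left (Real.exp_pos _).le (Real.abs_sin_le_one _)
  have h := integral_of_hasDerivAt_of_tendsto hd ((hc.const_mul t).sub (hs.const_mul (2 * B)))
    (hlim atBot ((tendsto_pow_atTop two_ne_zero).comp tendsto_abs_atBot_atTop |>.congr fun k => by
      simp))
    (hlim atTop (tendsto_pow_atTop two_ne_zero))
  rw [integral_sub (hc.const_mul t) (hs.const_mul (2 * B)), integral_const_mul,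
    integral_const_mul, integral_cos_mul_exp_neg_mul_sq hB, sub_zero, sub_eq_zero] at h
  rw [div_mul_eq_mul_div, h]
  exact (mul_div_cancel_left₀ _ (by positivity)).symm

theorem integral_Ioi_mul_sin_mul_exp_neg_mul_sq {B : ℝ} (hB : 0 < B) (t : ℝ) :
    ∫ k in Ioi (0 : ℝ), k * Real.sin (t * k) * Real.exp (-B * k ^ 2) =
      t / (4 * B) * (Real.sqrt (Real.pi / B) * Real.exp (-t ^ 2 / (4 * B))) := by
  have h := integral_comp_abs (f := fun k => k * Real.sin (t * k) * Real.exp (-B * k ^ 2))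
  have h2 : ∀ k : ℝ, |k| * Real.sin (t * |k|) * Real.exp (-B * |k| ^ 2) =
      k * Real.sin (t * k) * Real.exp (-B * k ^ 2) := by
    intro k
    rcases abs_cases k with ⟨h, _⟩ | ⟨h, _⟩ <;> rw [h]
    simp
  simp_rw [h2] at h
  rw [integral_mul_sin_mul_exp_neg_mul_sq hB] at h
  have : t / (4 * B) = t / (2 * B) / 2 := by ring
  rw [this]
  linarith

/-- The Bessel function `J₀(2z)`. -/
noncomputable def bessel (z : ℝ) : ℝ :=
  (2 * Real.pi)⁻¹ * ∫ θ in Ioo (-Real.pi) Real.pi, Real.cos (2 * z * Real.cos θ)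

theorem abs_bessel_le_one (z : ℝ) : |bessel z| ≤ 1 := by
  have h : ‖∫ θ in Ioo (-Real.pi) Real.pi, Real.cos (2 * z * Real.cos θ)‖ ≤
      1 * volume.real (Ioo (-Real.pi) Real.pi) :=
    norm_setIntegral_le_of_norm_le_const (by simp) (fun θ _ => Real.abs_cos_le_one _)
  rw [Real.volume_real_Ioo_of_le (by linarith [Real.pi_pos]), Real.norm_eq_abs] at h
  unfold bessel
  have hp := Real.pi_pos
  rw [abs_mul, abs_of_pos (by positivity), inv_mul_le_iff₀ (by positivity)]
  linarith

theorem continuous_bessel : Continuous bessel := by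
  unfold bessel
  refine continuous_const.mul ?_
  refine continuous_of_dominated (bound := fun _ => 1) (fun z => by fun_prop)
    (fun z => ae_of_all _ fun θ => Real.abs_cos_le_one _) ?_ (ae_of_all _ fun θ => by fun_prop)
  rw [integrable_const_iff]
  right
  exact ⟨by simp⟩

/-- The Riemann–Lebesgue lemma for the sine and cosine transforms. -/
theorem tendsto_integral_mul_cos (s : Set ℝ) (hs : MeasurableSet s) (f : ℝ → ℝ)
    (hf : IntegrableOn f s) :
    Tendsto (fun k : ℝ => ∫ v in s, f v * Real.cos (2 * k * v)) atTop (𝓝 0) ∧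
    Tendsto (fun k : ℝ => ∫ v in s, f v * Real.sin (2 * k * v)) atTop (𝓝 0) := by
  set F : ℝ → ℂ := fun v => ((s.indicator f v : ℝ) : ℂ)
  have h := Real.tendsto_integral_exp_smul_cocompact F
  have hk : Tendsto (fun k : ℝ => k / Real.pi) atTop (cocompact ℝ) :=
    (tendsto_id.atTop_div_const Real.pi_pos).mono_right atTop_le_cocompact
  have h1 := h.comp hk
  have hint : ∀ k : ℝ, Integrable (fun v => Real.fourierChar (-(v * (k / Real.pi))) • F v) := by
    intro k
    have hF : Integrable F := ((integrable_indicator_iff hs).2 hf).ofReal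
    refine hF.norm.mono' ?_ (ae_of_all _ fun v => by
      rw [Circle.smul_def, norm_smul, Circle.norm_coe, one_mul])
    simp only [Circle.smul_def]
    refine AEStronglyMeasurable.smul
      (f := fun v => (Real.fourierChar (-(v * (k / Real.pi))) : ℂ)) ?_ hF.aestronglyMeasurable
    exact (continuous_subtype_val.comp
      (Real.continuous_fourierChar.comp (by fun_prop))).aestronglyMeasurable
  have hval : ∀ k v : ℝ, Real.fourierChar (-(v * (k / Real.pi))) • F v =
      ((s.indicator f v * Real.cos (2 * k * v) : ℝ) : ℂ) -
        ((s.indicator f v * Real.sin (2 * k * v) : ℝ) : ℂ) * Complex.I := by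
    intro k v
    rw [Circle.smul_def, Real.fourierChar_apply]
    have e : (2 * Real.pi * -(v * (k / Real.pi))) = -(2 * k * v) := by
      have := Real.pi_ne_zero
      field_simp
    rw [e, Complex.exp_mul_I]
    simp only [F]
    push_cast
    rw [Complex.cos_neg, Complex.sin_neg, smul_eq_mul]
    ring
  have hre : ∀ k : ℝ, (∫ v, Real.fourierChar (-(v * (k / Real.pi))) • F v).re =
      ∫ v in s, f v * Real.cos (2 * k * v) := by
    intro k
    refine (integral_re (hint k)).symm.trans ?_
    rw [← integral_indicator hs]
    refine integral_congr_ae (ae_of_all _ fun v => ?_)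
    simp only [hval]
    change (((_ : ℝ) : ℂ) - ((_ : ℝ) : ℂ) * Complex.I).re = _
    rw [Complex.sub_re, Complex.re_ofReal_mul, Complex.ofReal_re, Complex.I_re]
    by_cases hv : v ∈ s <;> simp [hv]
  have him : ∀ k : ℝ, (∫ v, Real.fourierChar (-(v * (k / Real.pi))) • F v).im =
      -∫ v in s, f v * Real.sin (2 * k * v) := by
    intro k
    refine (integral_im (hint k)).symm.trans ?_
    rw [← integral_indicator hs, ← integral_neg]
    refine integral_congr_ae (ae_of_all _ fun v => ?_)
    simp only [hval]
    change (((_ : ℝ) : ℂ) - ((_ : ℝ) : ℂ) * Complex.I).im = _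
    rw [Complex.sub_im, Complex.im_ofReal_mul, Complex.ofReal_im, Complex.I_im]
    by_cases hv : v ∈ s <;> simp [hv]
  constructor
  · have := (Complex.continuous_re.tendsto 0).comp h1
    simpa [Function.comp_def, hre] using this
  · have := ((Complex.continuous_im.tendsto 0).comp h1).neg
    simpa [Function.comp_def, him] using this

/-- With `s = cos θ` the integral becomes the cosine transform of the integrable function `(1 -
s^2)^(-1/2)`, and Riemann–Lebesgue applies. -/
theorem tendsto_bessel : Tendsto bessel atTop (𝓝 0) := by
  have hm : MeasurableSet (Ioo 0 Real.pi) := measurableSet_Ioo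
  have hd : ∀ x ∈ Ioo 0 Real.pi, HasDerivWithinAt Real.cos (-Real.sin x) (Ioo 0 Real.pi) x :=
    fun x _ => (Real.hasDerivAt_cos x).hasDerivWithinAt
  have hinj : InjOn Real.cos (Ioo 0 Real.pi) := Real.injOn_cos.mono Ioo_subset_Icc_self
  have hsq : ∀ θ ∈ Ioo 0 Real.pi, |-Real.sin θ| * (Real.sqrt (1 - Real.cos θ ^ 2))⁻¹ = 1 := by
    intro θ hθ
    have := Real.sin_pos_of_pos_of_lt_pi hθ.1 hθ.2
    rw [← Real.abs_sin_eq_sqrt_one_sub_cos_sq, abs_neg]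
    exact mul_inv_cancel₀ (abs_pos.2 this.ne').ne'
  have hint : IntegrableOn (fun s : ℝ => (Real.sqrt (1 - s ^ 2))⁻¹) (Real.cos '' Ioo 0 Real.pi) := by
    rw [integrableOn_image_iff_integrableOn_abs_deriv_smul hm hd hinj]
    refine IntegrableOn.congr_fun (f := fun _ => (1 : ℝ)) ?_ (fun θ hθ => (hsq θ hθ).symm) hm
    simp
  have himg : MeasurableSet (Real.cos '' Ioo 0 Real.pi) := by
    have := MeasurableSet.image_of_continuousOn_injOn hm Real.continuous_cos.continuousOn hinj
    exact this
  have hRL := (tendsto_integral_mul_cos _ himg _ hint).1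
  have heq : ∀ z, bessel z = Real.pi⁻¹ * ∫ s in Real.cos '' Ioo 0 Real.pi,
      (Real.sqrt (1 - s ^ 2))⁻¹ * Real.cos (2 * z * s) := by
    intro z
    rw [integral_image_eq_integral_abs_deriv_smul hm hd hinj]
    have h1 : ∫ θ in Ioo 0 Real.pi, |-Real.sin θ| • ((Real.sqrt (1 - Real.cos θ ^ 2))⁻¹ *
        Real.cos (2 * z * Real.cos θ)) = ∫ θ in Ioo 0 Real.pi, Real.cos (2 * z * Real.cos θ) := by
      refine setIntegral_congr_fun hm fun θ hθ => ?_
      simp only [smul_eq_mul]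
      rw [← mul_assoc, hsq θ hθ, one_mul]
    rw [h1]
    unfold bessel
    have hp := Real.pi_pos
    rw [← integral_Ioc_eq_integral_Ioo, ← integral_Ioc_eq_integral_Ioo,
      ← intervalIntegral.integral_of_le (by linarith), ← intervalIntegral.integral_of_le hp.le]
    have hi : ∀ a b : ℝ, IntervalIntegrable (fun θ => Real.cos (2 * z * Real.cos θ)) volume a b :=
      fun a b => Continuous.intervalIntegrable (by fun_prop) a b
    rw [← intervalIntegral.integral_add_adjacent_intervals (hi (-Real.pi) 0) (hi 0 Real.pi)]
    have hneg := intervalIntegral.integral_comp_neg (a := 0) (b := Real.pi)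
      (fun θ => Real.cos (2 * z * Real.cos θ))
    simp only [Real.cos_neg, neg_zero] at hneg
    rw [← hneg]
    field_simp
    ring
  have := hRL.const_mul Real.pi⁻¹
  rw [mul_zero] at this
  exact this.congr fun z => (heq z).symm

/-- The plane integral of `cos(2sx) exp(-B(x^2+y^2))` is computed twice: as a product of line
integrals, and in polar coordinates, where the angular integral is the Bessel function. -/
theorem integral_Ioi_bessel_mul_exp_neg_mul_sq {B : ℝ} (hB : 0 < B) (s : ℝ) :
    ∫ k in Ioi (0 : ℝ), k * bessel (s * k) * Real.exp (-B * k ^ 2) =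
      (2 * B)⁻¹ * Real.exp (-s ^ 2 / B) := by
  set g : ℝ × ℝ → ℝ := fun p =>
    (Real.cos (2 * s * p.1) * Real.exp (-B * p.1 ^ 2)) * Real.exp (-B * p.2 ^ 2) with hg
  have h1 : ∫ p, g p = Real.pi / B * Real.exp (-s ^ 2 / B) := by
    have h := integral_prod_mul (μ := (volume : Measure ℝ)) (ν := (volume : Measure ℝ))
      (fun x : ℝ => Real.cos (2 * s * x) * Real.exp (-B * x ^ 2))
      (fun x : ℝ => Real.exp (-B * x ^ 2))
    rw [integral_cos_mul_exp_neg_mul_sq hB, integral_gaussian] at h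
    refine h.trans ?_
    rw [mul_right_comm, Real.mul_self_sqrt (by positivity)]
    congr 2
    field_simp
    ring
  rw [← integral_comp_polarCoord_symm] at h1
  have h2 : ∀ p : ℝ × ℝ, p.1 • g (polarCoord.symm p) =
      p.1 * Real.exp (-B * p.1 ^ 2) * Real.cos (2 * (s * p.1) * Real.cos p.2) := by
    intro p
    simp only [hg, polarCoord_symm_apply, smul_eq_mul]
    rw [mul_assoc (Real.cos _), ← Real.exp_add]
    have : -B * (p.1 * Real.cos p.2) ^ 2 + -B * (p.1 * Real.sin p.2) ^ 2 = -B * p.1 ^ 2 := by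
      linear_combination (-B * p.1 ^ 2) * Real.sin_sq_add_cos_sq p.2
    rw [this]
    ring_nf
  simp_rw [h2] at h1
  have hset : polarCoord.target = Ioi (0 : ℝ) ×ˢ Ioo (-Real.pi) Real.pi := rfl
  rw [hset] at h1
  have hint : IntegrableOn (fun p : ℝ × ℝ =>
      p.1 * Real.exp (-B * p.1 ^ 2) * Real.cos (2 * (s * p.1) * Real.cos p.2))
      (Ioi (0 : ℝ) ×ˢ Ioo (-Real.pi) Real.pi) := by
    have hb : IntegrableOn (fun p : ℝ × ℝ => (p.1 * Real.exp (-B * p.1 ^ 2)) * (1 : ℝ))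
        (Ioi (0 : ℝ) ×ˢ Ioo (-Real.pi) Real.pi) := by
      rw [IntegrableOn, Measure.volume_eq_prod, ← Measure.prod_restrict]
      exact (integrable_mul_exp_neg_mul_sq hB).integrableOn.mul_prod
        (g := fun _ : ℝ => (1 : ℝ)) (by simp)
    refine hb.norm.mono' (Continuous.aestronglyMeasurable (by fun_prop)) (ae_of_all _ fun p => ?_)
    rw [norm_mul, norm_mul _ (1 : ℝ)]
    refine mul_le_mul_of_nonneg_left ?_ (norm_nonneg _)
    rw [norm_one]
    exact Real.abs_cos_le_one _
  rw [Measure.volume_eq_prod, setIntegral_prod _ (by rwa [← Measure.volume_eq_prod])] at h1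
  have h3 : ∀ k : ℝ, ∫ θ in Ioo (-Real.pi) Real.pi,
      k * Real.exp (-B * k ^ 2) * Real.cos (2 * (s * k) * Real.cos θ) =
      (2 * Real.pi) * (k * bessel (s * k) * Real.exp (-B * k ^ 2)) := by
    intro k
    rw [integral_const_mul, bessel]
    have hp := Real.pi_pos
    field_simp
  simp_rw [h3] at h1
  rw [integral_const_mul] at h1
  have hp := Real.pi_pos
  rw [eq_inv_mul_iff_mul_eq₀ (by positivity)]
  have : 2 * Real.pi ≠ 0 := by positivity
  refine mul_left_cancel₀ this ?_
  rw [show 2 * Real.pi * (2 * B * ∫ k in Ioi (0 : ℝ), k * bessel (s * k) * Real.exp (-B * k ^ 2)) =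
    2 * B * (2 * Real.pi * ∫ k in Ioi (0 : ℝ), k * bessel (s * k) * Real.exp (-B * k ^ 2)) by ring,
    h1]
  field_simp

/-! ### Averages over the frequency density -/

/-- The density of `√S`, where `S` has density `hypoexp n`. -/
noncomputable def freqDensity (n : ℕ) (k : ℝ) : ℝ :=
  ∑ j ∈ Finset.Icc 1 n, weight n j * (2 / j * (k * Real.exp (-(j : ℝ)⁻¹ * k ^ 2)))

/-- The change of variables `x = k^2` carries the positivity of `hypoexp` over. -/
theorem freqDensity_nonneg {n : ℕ} (hn : 1 ≤ n) {k : ℝ} (hk : 0 ≤ k) : 0 ≤ freqDensity n k := by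
  have h : freqDensity n k = 2 * k * hypoexp n (k ^ 2) := by
    unfold freqDensity hypoexp
    rw [Finset.mul_sum]
    refine Finset.sum_congr rfl fun j _ => ?_
    rw [show -(j : ℝ)⁻¹ * k ^ 2 = -k ^ 2 / j by ring]
    ring
  rw [h]
  have := hypoexp_nonneg hn (sq_nonneg k)
  positivity

theorem continuous_freqDensity (n : ℕ) : Continuous (freqDensity n) := by
  unfold freqDensity
  fun_prop

theorem integrableOn_freqDensity_mul (n : ℕ) {F : ℝ → ℝ}
    (hF : ∀ B : ℝ, 0 < B → IntegrableOn (fun k => k * F k * Real.exp (-B * k ^ 2)) (Ioi 0)) :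
    IntegrableOn (fun k => freqDensity n k * F k) (Ioi 0) := by
  have : (fun k => freqDensity n k * F k) = fun k => ∑ j ∈ Finset.Icc 1 n,
      (weight n j * (2 / j)) * (k * F k * Real.exp (-(j : ℝ)⁻¹ * k ^ 2)) := by
    ext k
    unfold freqDensity
    rw [Finset.sum_mul]
    refine Finset.sum_congr rfl fun j _ => ?_
    ring
  rw [this]
  refine integrable_finsetSum _ fun j hj => ?_
  have hj0 : 0 < (j : ℝ) := by simp at hj; simp; omega
  exact (hF _ (inv_pos.2 hj0)).const_mul _

theorem integral_freqDensity_mul (n : ℕ) {F : ℝ → ℝ}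
    (hF : ∀ B : ℝ, 0 < B → IntegrableOn (fun k => k * F k * Real.exp (-B * k ^ 2)) (Ioi 0)) :
    ∫ k in Ioi 0, freqDensity n k * F k = ∑ j ∈ Finset.Icc 1 n,
      weight n j * (2 / j * ∫ k in Ioi 0, k * F k * Real.exp (-(j : ℝ)⁻¹ * k ^ 2)) := by
  have : (fun k => freqDensity n k * F k) = fun k => ∑ j ∈ Finset.Icc 1 n,
      (weight n j * (2 / j)) * (k * F k * Real.exp (-(j : ℝ)⁻¹ * k ^ 2)) := by
    ext k
    unfold freqDensity
    rw [Finset.sum_mul]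
    refine Finset.sum_congr rfl fun j _ => ?_
    ring
  rw [this, integral_finsetSum]
  · refine Finset.sum_congr rfl fun j _ => ?_
    rw [integral_const_mul, mul_assoc]
  · intro j hj
    have hj0 : 0 < (j : ℝ) := by simp at hj; simp; omega
    exact (hF _ (inv_pos.2 hj0)).const_mul _

theorem integrableOn_mul_mul_exp_neg_mul_sq_of_bounded {F : ℝ → ℝ} {M : ℝ}
    (hF : AEStronglyMeasurable F (volume.restrict (Ioi 0))) (hM : ∀ k ∈ Ioi (0 : ℝ), |F k| ≤ M)
    {B : ℝ} (hB : 0 < B) :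
    IntegrableOn (fun k => k * F k * Real.exp (-B * k ^ 2)) (Ioi 0) := by
  have h := (integrable_mul_exp_neg_mul_sq hB).integrableOn (s := Ioi 0)
  have := h.mul_bdd hF
    ((ae_restrict_iff' measurableSet_Ioi).2 (ae_of_all _ hM))
  exact this.congr (ae_of_all _ fun k => by simp only; ring)

theorem integrableOn_freqDensity (n : ℕ) : IntegrableOn (freqDensity n) (Ioi 0) := by
  have := integrableOn_freqDensity_mul n (F := fun _ => 1) fun B hB =>
    integrableOn_mul_mul_exp_neg_mul_sq_of_bounded (M := 1) (by fun_prop) (by simp) hB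
  simpa using this

theorem integral_freqDensity {n : ℕ} (hn : 1 ≤ n) : ∫ k in Ioi 0, freqDensity n k = 1 := by
  have h := integral_freqDensity_mul n (F := fun _ => 1) fun B hB =>
    integrableOn_mul_mul_exp_neg_mul_sq_of_bounded (M := 1) (by fun_prop) (by simp) hB
  simp only [mul_one] at h
  rw [h, ← sum_weight hn]
  refine Finset.sum_congr rfl fun j hj => ?_
  have hj0 : 0 < (j : ℝ) := by simp at hj; simp; omega
  rw [integral_Ioi_mul_exp_neg_mul_sq (inv_pos.2 hj0)]
  field_simp

theorem integral_freqDensity_mul_exp (n : ℕ) {b : ℝ} (hb : 0 < b) :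
    ∫ k in Ioi 0, freqDensity n k * Real.exp (-b * k ^ 2) =
      ∑ j ∈ Finset.Icc 1 n, weight n j / (1 + b * j) := by
  have h := integral_freqDensity_mul n (F := fun k => Real.exp (-b * k ^ 2)) fun B hB =>
    integrableOn_mul_mul_exp_neg_mul_sq_of_bounded (M := 1) (by fun_prop)
      (fun k _ => by
        rw [Real.abs_exp, Real.exp_le_one_iff]
        nlinarith [sq_nonneg k]) hB
  rw [h]
  refine Finset.sum_congr rfl fun j hj => ?_
  have hj0 : 0 < (j : ℝ) := by simp at hj; simp; omega
  have : ∀ k : ℝ, k * Real.exp (-b * k ^ 2) * Real.exp (-(j : ℝ)⁻¹ * k ^ 2) =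
      k * Real.exp (-(b + (j : ℝ)⁻¹) * k ^ 2) := by
    intro k
    rw [mul_assoc, ← Real.exp_add]
    ring_nf
  simp_rw [this]
  rw [integral_Ioi_mul_exp_neg_mul_sq (by positivity)]
  field_simp
  ring

/-- The mass of `freqDensity n` escapes to infinity. -/
theorem tendsto_integral_freqDensity_mul {Θ : ℝ → ℝ} {M : ℝ}
    (hM : ∀ k ∈ Ioi (0 : ℝ), |Θ k| ≤ M)
    (hlim : Tendsto Θ atTop (𝓝 0)) :
    Tendsto (fun n : ℕ => ∫ k in Ioi 0, freqDensity n k * Θ k) atTop (𝓝 0) := by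
  have hM0 : 0 ≤ M := (abs_nonneg _).trans (hM 1 (by simp))
  rw [Metric.tendsto_atTop]
  intro ε hε
  obtain ⟨A, hA⟩ := (Metric.tendsto_atTop.1 hlim) (ε / 2) (by positivity)
  set A' := max A 1
  have hA' : 0 < A' := lt_of_lt_of_le one_pos (le_max_right _ _)
  -- Chosen so that `e · exp(-b k^2) ≥ 1` for `0 < k ≤ A'`: one Gaussian dominates `Θ` where it is
  -- not small, and the average of a Gaussian is the Laplace transform already known to tend to `0`.
  set b := (A' ^ 2)⁻¹
  have hb : 0 < b := by positivity
  have ht := (tendsto_sum_weight_div_one_add hb).const_mul (M * Real.exp 1)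
  rw [mul_zero] at ht
  obtain ⟨N, hN⟩ := (Metric.tendsto_atTop.1 ht) (ε / 2) (by positivity)
  refine ⟨max N 1, fun n hn => ?_⟩
  have hn1 : 1 ≤ n := (le_max_right _ _).trans hn
  have hN' := hN n ((le_max_left _ _).trans hn)
  rw [Real.dist_0_eq_abs] at hN' ⊢
  have hbd : ∀ k ∈ Ioi (0 : ℝ), |Θ k| ≤ ε / 2 + M * Real.exp 1 * Real.exp (-b * k ^ 2) := by
    intro k hk
    rcases le_or_gt A' k with h | h
    · have := hA k ((le_max_left _ _).trans h)
      rw [Real.dist_0_eq_abs] at this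
      have : 0 ≤ M * Real.exp 1 * Real.exp (-b * k ^ 2) := by positivity
      linarith
    · have h1 : 1 ≤ Real.exp 1 * Real.exp (-b * k ^ 2) := by
        rw [← Real.exp_add]
        apply Real.one_le_exp
        have : b * k ^ 2 ≤ 1 := by
          rw [inv_mul_le_iff₀ (by positivity), mul_one]
          have : 0 < k := hk
          gcongr
        linarith
      have := hM k hk
      have := mul_le_mul_of_nonneg_left h1 hM0
      linarith
  have hi1 := integrableOn_freqDensity n
  have hi2 : IntegrableOn (fun k => freqDensity n k * Real.exp (-b * k ^ 2)) (Ioi 0) :=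
    integrableOn_freqDensity_mul n fun B hB =>
      integrableOn_mul_mul_exp_neg_mul_sq_of_bounded (M := 1) (by fun_prop)
        (fun k _ => by
          rw [Real.abs_exp, Real.exp_le_one_iff]
          nlinarith [sq_nonneg k]) hB
  have hle : |∫ k in Ioi 0, freqDensity n k * Θ k| ≤
      ∫ k in Ioi 0, (freqDensity n k * (ε / 2) +
        freqDensity n k * Real.exp (-b * k ^ 2) * (M * Real.exp 1)) := by
    rw [← Real.norm_eq_abs]
    refine norm_integral_le_of_norm_le ((hi1.mul_const _).add (hi2.mul_const _)) ?_
    refine (ae_restrict_iff' measurableSet_Ioi).2 (ae_of_all _ fun k hk => ?_)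
    have h0 := freqDensity_nonneg hn1 (le_of_lt hk)
    rw [norm_mul, Real.norm_eq_abs, Real.norm_eq_abs, abs_of_nonneg h0]
    refine (mul_le_mul_of_nonneg_left (hbd k hk) h0).trans (le_of_eq (by ring))
  rw [integral_add (hi1.mul_const _) (hi2.mul_const _), integral_mul_const, integral_mul_const,
    integral_freqDensity hn1, integral_freqDensity_mul_exp n hb] at hle
  have := le_abs_self (M * Real.exp 1 * ∑ j ∈ Finset.Icc 1 n, weight n j / (1 + b * j))
  linarith

/-- Each `√j exp(-j y^2)` is, up to a constant, the average of `sin(2yk)/y` over the density `(2/j)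
k exp(-k^2/j)`; the weights combine these densities into `freqDensity n`. -/
theorem sum_weight_mul_sqrt_mul_exp (n : ℕ) {y : ℝ} (hy : 0 < y) :
    ∑ j ∈ Finset.Icc 1 n, weight n j * (Real.sqrt j * Real.exp (-(j : ℝ) * y ^ 2)) =
      (Real.sqrt Real.pi)⁻¹ * ∫ k in Ioi 0, freqDensity n k * (Real.sin (2 * y * k) / y) := by
  rw [integral_freqDensity_mul n (F := fun k => Real.sin (2 * y * k) / y) fun B hB =>
    integrableOn_mul_mul_exp_neg_mul_sq_of_bounded (M := 1 / y) (by fun_prop)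
      (fun k _ => by
        rw [abs_div, abs_of_pos hy]
        gcongr
        exact Real.abs_sin_le_one _) hB, Finset.mul_sum]
  refine Finset.sum_congr rfl fun j hj => ?_
  have hj0 : 0 < (j : ℝ) := by simp at hj; simp; omega
  have h := integral_Ioi_mul_sin_mul_exp_neg_mul_sq (inv_pos.2 hj0) (2 * y)
  have h2 : ∀ k : ℝ, k * (Real.sin (2 * y * k) / y) * Real.exp (-(j : ℝ)⁻¹ * k ^ 2) =
      y⁻¹ * (k * Real.sin (2 * y * k) * Real.exp (-(j : ℝ)⁻¹ * k ^ 2)) := by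
    intro k; ring
  simp_rw [h2]
  rw [integral_const_mul, h, div_inv_eq_mul, Real.sqrt_mul Real.pi_pos.le]
  have e : -(2 * y) ^ 2 / (4 * (j : ℝ)⁻¹) = -(j : ℝ) * y ^ 2 := by field_simp; ring
  rw [e]
  have hp : Real.sqrt Real.pi ≠ 0 := by positivity
  field_simp
  ring

/-- The same averaging with `J₀` in place of the sine kernel. Since `|J₀| ≤ 1`, the alternating sum
is bounded uniformly in `n`. -/
theorem sum_weight_mul_exp (n : ℕ) {c : ℝ} (hc : 0 ≤ c) :
    ∑ j ∈ Finset.Icc 1 n, weight n j * Real.exp (-(j : ℝ) * c) =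
      ∫ k in Ioi 0, freqDensity n k * bessel (Real.sqrt c * k) := by
  rw [integral_freqDensity_mul n (F := fun k => bessel (Real.sqrt c * k)) fun B hB =>
    integrableOn_mul_mul_exp_neg_mul_sq_of_bounded (M := 1)
      (continuous_bessel.comp (by fun_prop)).aestronglyMeasurable
      (fun k _ => abs_bessel_le_one _) hB]
  refine Finset.sum_congr rfl fun j hj => ?_
  have hj0 : 0 < (j : ℝ) := by simp at hj; simp; omega
  rw [integral_Ioi_bessel_mul_exp_neg_mul_sq (inv_pos.2 hj0), Real.sq_sqrt hc, div_inv_eq_mul]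
  rw [show -c * (j : ℝ) = -j * c by ring]
  field_simp

theorem abs_sum_weight_mul_exp_le {n : ℕ} (hn : 1 ≤ n) {c : ℝ} (hc : 0 ≤ c) :
    |∑ j ∈ Finset.Icc 1 n, weight n j * Real.exp (-(j : ℝ) * c)| ≤ 1 := by
  rw [sum_weight_mul_exp n hc, ← integral_freqDensity hn, ← Real.norm_eq_abs]
  refine norm_integral_le_of_norm_le (integrableOn_freqDensity n) ?_
  refine (ae_restrict_iff' measurableSet_Ioi).2 (ae_of_all _ fun k hk => ?_)
  have h0 := freqDensity_nonneg hn (le_of_lt hk)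
  rw [norm_mul, Real.norm_eq_abs, Real.norm_eq_abs, abs_of_nonneg h0]
  exact mul_le_of_le_one_right h0 (abs_bessel_le_one _)

theorem tendsto_sum_weight_mul_exp {c : ℝ} (hc : 0 < c) :
    Tendsto (fun n : ℕ => ∑ j ∈ Finset.Icc 1 n, weight n j * Real.exp (-(j : ℝ) * c)) atTop
      (𝓝 0) := by
  simp_rw [fun n => sum_weight_mul_exp n hc.le]
  refine tendsto_integral_freqDensity_mul (M := 1)
    (fun k _ => abs_bessel_le_one _) (tendsto_bessel.comp ?_)
  exact tendsto_id.const_mul_atTop (Real.sqrt_pos.2 hc)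

/-! ### Central binomial coefficients compared with `(πj)^(-1/2)` -/

theorem hasDerivAt_sqrt_exp_sub_one {t : ℝ} (ht : 0 < t) :
    HasDerivAt (fun t => Real.sqrt (Real.exp t - 1))
      (Real.exp t / (2 * Real.sqrt (Real.exp t - 1))) t := by
  have h : Real.exp t - 1 ≠ 0 := by
    have := Real.add_one_lt_exp ht.ne'
    linarith
  exact ((Real.hasDerivAt_exp t).sub_const 1).sqrt h

theorem integral_inv_sqrt_exp_sub_one :
    IntegrableOn (fun t => (Real.sqrt (Real.exp t - 1))⁻¹) (Ioi 0) ∧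
      ∫ t in Ioi (0 : ℝ), (Real.sqrt (Real.exp t - 1))⁻¹ = Real.pi := by
  have hc : ContinuousWithinAt (fun t => 2 * Real.arctan (Real.sqrt (Real.exp t - 1)))
      (Ici 0) 0 := by
    apply Continuous.continuousWithinAt
    fun_prop
  have hd : ∀ t ∈ Ioi (0 : ℝ), HasDerivAt (fun t => 2 * Real.arctan (Real.sqrt (Real.exp t - 1)))
      (Real.sqrt (Real.exp t - 1))⁻¹ t := by
    intro t ht
    refine (((hasDerivAt_sqrt_exp_sub_one ht).arctan).const_mul 2).congr_deriv ?_
    have h := Real.add_one_lt_exp (ne_of_gt ht)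
    have h0 : 0 < Real.exp t - 1 := by have : 0 < t := ht; linarith
    have hs := Real.sqrt_pos.2 h0
    rw [Real.sq_sqrt h0.le]
    have := Real.exp_pos t
    field_simp
    ring
  have hn : ∀ t ∈ Ioi (0 : ℝ), 0 ≤ (Real.sqrt (Real.exp t - 1))⁻¹ := fun t _ => by positivity
  have hl : Tendsto (fun t => 2 * Real.arctan (Real.sqrt (Real.exp t - 1))) atTop
      (𝓝 Real.pi) := by
    have h1 : Tendsto (fun t => Real.sqrt (Real.exp t - 1)) atTop atTop :=
      Real.tendsto_sqrt_atTop.comp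
        (tendsto_atTop_add_const_right _ (-1) Real.tendsto_exp_atTop)
    have h2 := ((Real.tendsto_arctan_atTop.mono_right nhdsWithin_le_nhds).comp h1).const_mul 2
    rwa [mul_div_cancel₀ _ two_ne_zero] at h2
  refine ⟨integrableOn_Ioi_deriv_of_nonneg hc hd hn hl, ?_⟩
  rw [integral_Ioi_of_hasDerivAt_of_nonneg hc hd hn hl]
  simp

theorem integrableOn_exp_mul_inv_sqrt (j : ℕ) :
    IntegrableOn (fun t => Real.exp (-(j : ℝ) * t) * (Real.sqrt (Real.exp t - 1))⁻¹) (Ioi 0) := by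
  refine integral_inv_sqrt_exp_sub_one.1.mono' (by fun_prop) ?_
  refine (ae_restrict_iff' measurableSet_Ioi).2 (ae_of_all _ fun t ht => ?_)
  have ht : 0 < t := ht
  rw [norm_mul, Real.norm_eq_abs, Real.abs_exp, Real.norm_eq_abs, abs_inv,
    abs_of_nonneg (Real.sqrt_nonneg _)]
  refine mul_le_of_le_one_left (by positivity) ?_
  rw [Real.exp_le_one_iff]
  have : 0 ≤ (j : ℝ) * t := by positivity
  linarith

/-- The function `exp(-(j+1)t) √(exp t - 1)` vanishes at both ends, so the integral of its
derivative is `0`. This is the recursion satisfied by `C(2j,j)/4^j`. -/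
theorem integral_exp_mul_inv_sqrt (j : ℕ) :
    ∫ t in Ioi (0 : ℝ), Real.exp (-(j : ℝ) * t) * (Real.sqrt (Real.exp t - 1))⁻¹ =
      Real.pi * (j.centralBinom / 4 ^ j) := by
  induction j with
  | zero => simpa using integral_inv_sqrt_exp_sub_one.2
  | succ j ih =>
    set G : ℕ → ℝ := fun j =>
      ∫ t in Ioi (0 : ℝ), Real.exp (-(j : ℝ) * t) * (Real.sqrt (Real.exp t - 1))⁻¹ with hG
    have hi := integrableOn_exp_mul_inv_sqrt j
    have hi' := integrableOn_exp_mul_inv_sqrt (j + 1)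
    have hd : ∀ t ∈ Ioi (0 : ℝ), HasDerivAt
        (fun t => Real.exp (-((j + 1 : ℕ) : ℝ) * t) * Real.sqrt (Real.exp t - 1))
        ((1 / 2 - (j + 1)) * (Real.exp (-(j : ℝ) * t) * (Real.sqrt (Real.exp t - 1))⁻¹) +
          (j + 1) * (Real.exp (-((j + 1 : ℕ) : ℝ) * t) * (Real.sqrt (Real.exp t - 1))⁻¹)) t := by
      intro t ht
      have h1 : HasDerivAt (fun t => Real.exp (-((j + 1 : ℕ) : ℝ) * t))
          (Real.exp (-((j + 1 : ℕ) : ℝ) * t) * (-((j + 1 : ℕ) : ℝ) * 1)) t :=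
        ((hasDerivAt_id t).const_mul _).exp
      refine (h1.mul (hasDerivAt_sqrt_exp_sub_one ht)).congr_deriv ?_
      have h := Real.add_one_lt_exp (ne_of_gt ht)
      have h0 : 0 < Real.exp t - 1 := by have : 0 < t := ht; linarith
      have hs := Real.sqrt_pos.2 h0
      have hsq := Real.sq_sqrt h0.le
      have he : Real.exp (-(j : ℝ) * t) = Real.exp (-((j + 1 : ℕ) : ℝ) * t) * Real.exp t := by
        rw [← Real.exp_add]; push_cast; ring_nf
      rw [he]
      push_cast
      field_simp
      rw [hsq]
      ring
    have hc : ContinuousWithinAt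
        (fun t => Real.exp (-((j + 1 : ℕ) : ℝ) * t) * Real.sqrt (Real.exp t - 1)) (Ici 0) 0 := by
      apply Continuous.continuousWithinAt
      fun_prop
    have hl : Tendsto (fun t => Real.exp (-((j + 1 : ℕ) : ℝ) * t) * Real.sqrt (Real.exp t - 1))
        atTop (𝓝 0) := by
      have hexp : Tendsto (fun t : ℝ => Real.exp (-(t / 2))) atTop (𝓝 0) :=
        Real.tendsto_exp_neg_atTop_nhds_zero.comp (tendsto_id.atTop_div_const two_pos)
      refine squeeze_zero' (Eventually.of_forall fun t => by positivity)
        (eventually_atTop.2 ⟨0, fun t ht => ?_⟩) hexp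
      have h1 : Real.sqrt (Real.exp t - 1) ≤ Real.exp (t / 2) := by
        rw [Real.sqrt_le_left (Real.exp_pos _).le, ← Real.exp_nat_mul]
        have : ((2 : ℕ) : ℝ) * (t / 2) = t := by push_cast; ring
        rw [this]; linarith
      have h2 : Real.exp (-((j + 1 : ℕ) : ℝ) * t) ≤ Real.exp (-t) := by
        rw [Real.exp_le_exp]
        push_cast
        have : 0 ≤ (j : ℝ) * t := by positivity
        linarith
      refine (mul_le_mul h2 h1 (Real.sqrt_nonneg _) (Real.exp_pos _).le).trans (le_of_eq ?_)
      rw [← Real.exp_add]; ring_nf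
    have h := integral_Ioi_of_hasDerivAt_of_tendsto hc hd
      ((hi.const_mul _).add (hi'.const_mul _)) hl
    rw [integral_add (hi.const_mul _) (hi'.const_mul _), integral_const_mul,
      integral_const_mul, ih] at h
    simp only [mul_zero, Real.exp_zero, sub_self, Real.sqrt_zero] at h
    have hb : ((j : ℝ) + 1) * ((j + 1).centralBinom : ℝ) =
        2 * (2 * j + 1) * (j.centralBinom : ℝ) := by
      exact_mod_cast Nat.succ_mul_centralBinom_succ j
    have hj : (j : ℝ) + 1 ≠ 0 := by positivity
    refine mul_left_cancel₀ hj ?_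
    rw [show ((j : ℝ) + 1) * (Real.pi * ((j + 1).centralBinom / 4 ^ (j + 1))) =
      Real.pi * ((((j : ℝ) + 1) * ((j + 1).centralBinom : ℝ)) / 4 ^ (j + 1)) by ring, hb]
    have e : Real.pi * (2 * (2 * (j : ℝ) + 1) * j.centralBinom / 4 ^ (j + 1)) =
      (j + 1 / 2) * (Real.pi * (j.centralBinom / 4 ^ j)) := by
      rw [pow_succ]; field_simp; ring
    rw [e]
    linarith

theorem integrableOn_exp_mul_inv_sqrt_id {j : ℝ} (hj : 0 < j) :
    IntegrableOn (fun t => Real.exp (-j * t) * (Real.sqrt t)⁻¹) (Ioi 0) := by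
  have h := integrableOn_rpow_mul_exp_neg_mul_rpow (p := 1) (s := -(1 / 2)) (b := j)
    (by norm_num) one_pos hj
  refine h.congr_fun (fun t ht => ?_) measurableSet_Ioi
  have ht : 0 < t := ht
  simp only [Real.rpow_one]
  rw [mul_comm, Real.rpow_neg ht.le, Real.sqrt_eq_rpow]

theorem integral_exp_mul_inv_sqrt_id {j : ℝ} (hj : 0 < j) :
    ∫ t in Ioi (0 : ℝ), Real.exp (-j * t) * (Real.sqrt t)⁻¹ = Real.sqrt (Real.pi / j) := by
  have h := Real.integral_rpow_mul_exp_neg_mul_Ioi (a := 1 / 2) (r := j) (by norm_num) hj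
  rw [Real.Gamma_one_half_eq, ← Real.sqrt_eq_rpow, ← Real.sqrt_mul (by positivity)] at h
  rw [show Real.pi / j = 1 / j * Real.pi by ring, ← h]
  refine setIntegral_congr_fun measurableSet_Ioi fun t ht => ?_
  have ht : 0 < t := ht
  rw [show (1 / 2 - 1 : ℝ) = -(1 / 2) by norm_num, Real.rpow_neg ht.le, Real.sqrt_eq_rpow,
    mul_comm, neg_mul]

/-- The derivative of `t ↦ t ^ (-1/2) - (exp t - 1) ^ (-1/2)`. -/
noncomputable def corrDensity (t : ℝ) : ℝ :=
  Real.exp t / (2 * Real.sqrt (Real.exp t - 1) ^ 3) - 1 / (2 * Real.sqrt t ^ 3)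

/-- At `0` the two `t^(-3/2)` singularities cancel to order `t^(-1/2)`; at infinity one term decays
exponentially and the other like `t^(-3/2)`. -/
theorem integrableOn_corrDensity : IntegrableOn corrDensity (Ioi 0) := by
  have hmeas : Measurable corrDensity := by unfold corrDensity; fun_prop
  have h1 : IntegrableOn corrDensity (Ioc 0 1) := by
    have hb : IntegrableOn (fun t : ℝ => 2 * t ^ (-(1 / 2) : ℝ)) (Ioc 0 1) := by
      rw [integrableOn_Ioc_iff_integrableOn_Ioo]
      exact ((intervalIntegral.integrableOn_Ioo_rpow_iff one_pos).2 (by norm_num)).const_mul 2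
    refine hb.mono' hmeas.aestronglyMeasurable ?_
    refine (ae_restrict_iff' measurableSet_Ioc).2 (ae_of_all _ fun t ht => ?_)
    have ht0 : 0 < t := ht.1
    have hE : Real.exp t - 1 ≥ t := by linarith [Real.add_one_le_exp t]
    have hE2 : Real.exp t - 1 - t ≤ t ^ 2 := by
      have := Real.abs_exp_sub_one_sub_id_le (x := t) (by rw [abs_of_pos ht0]; exact ht.2)
      exact (le_abs_self _).trans this
    rw [Real.rpow_neg ht0.le, ← Real.sqrt_eq_rpow, Real.norm_eq_abs, corrDensity]
    set s := Real.sqrt t with hs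
    set e := Real.sqrt (Real.exp t - 1) with he
    have hs0 : 0 < s := Real.sqrt_pos.2 ht0
    have hse : s ≤ e := Real.sqrt_le_sqrt hE
    have he0 : 0 < e := hs0.trans_le hse
    have hs2 : s ^ 2 = t := Real.sq_sqrt ht0.le
    have he2 : e ^ 2 = Real.exp t - 1 := Real.sq_sqrt (by linarith)
    have hexp : Real.exp t = 1 + e ^ 2 := by linarith
    have hdiff : e ^ 2 - s ^ 2 ≤ s ^ 4 := by
      rw [he2, hs2, show s ^ 4 = (s ^ 2) ^ 2 by ring, hs2]; exact hE2
    have hes : 2 * (e - s) ≤ s ^ 3 := by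
      have : 2 * s * (e - s) ≤ s * s ^ 3 := by nlinarith
      have h3 : s * (2 * (e - s)) ≤ s * s ^ 3 := by linarith
      exact le_of_mul_le_mul_left h3 hs0
    have hcube : 0 ≤ 1 / s ^ 3 - 1 / e ^ 3 ∧ 1 / s ^ 3 - 1 / e ^ 3 ≤ 3 / 2 * s⁻¹ := by
      constructor
      · rw [sub_nonneg]; gcongr
      · rw [div_sub_div _ _ (by positivity) (by positivity), div_le_iff₀ (by positivity)]
        have e1 : 3 / 2 * s⁻¹ * (s ^ 3 * e ^ 3) = 3 / 2 * s ^ 2 * e ^ 3 := by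
          field_simp
        rw [e1]
        have e2 : 1 * e ^ 3 - s ^ 3 * 1 = (e - s) * (e ^ 2 + e * s + s ^ 2) := by ring
        rw [e2]
        have e3 : e ^ 2 + e * s + s ^ 2 ≤ 3 * e ^ 2 := by nlinarith
        calc (e - s) * (e ^ 2 + e * s + s ^ 2) ≤ (s ^ 3 / 2) * (3 * e ^ 2) :=
              mul_le_mul (by linarith) e3 (by positivity) (by positivity)
          _ = 3 / 2 * s ^ 2 * e ^ 2 * s := by ring
          _ ≤ 3 / 2 * s ^ 2 * e ^ 2 * e := by gcongr
          _ = 3 / 2 * s ^ 2 * e ^ 3 := by ring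
    have hinv : e⁻¹ ≤ s⁻¹ := inv_anti₀ hs0 hse
    -- Writing `exp t = 1 + e^2` isolates the difference of the inverse cubes, which `hcube` bounds
    -- by a multiple of `1/s`.
    have hval : Real.exp t / (2 * e ^ 3) - 1 / (2 * s ^ 3) =
        1 / 2 * (e⁻¹ - (1 / s ^ 3 - 1 / e ^ 3)) := by
      rw [hexp]; field_simp; ring
    rw [hval, abs_le]
    have : 0 < e⁻¹ := by positivity
    constructor <;> linarith [hcube.1, hcube.2]
  have h2 : IntegrableOn corrDensity (Ioi 1) := by
    have hb : IntegrableOn (fun t : ℝ => 4 * Real.exp (-(1 / 2) * t) + t ^ (-(3 / 2) : ℝ))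
        (Ioi 1) :=
      ((integrableOn_exp_mul_Ioi (by norm_num) 1).const_mul 4).add
        (integrableOn_Ioi_rpow_of_lt (by norm_num) one_pos)
    refine hb.mono' hmeas.aestronglyMeasurable ?_
    refine (ae_restrict_iff' measurableSet_Ioi).2 (ae_of_all _ fun t ht => ?_)
    have ht1 : 1 < t := ht
    have ht0 : 0 < t := by linarith
    set p := Real.exp (1 / 2 * t) with hp
    have hp0 : 0 < p := Real.exp_pos _
    have hp2 : Real.exp t = p ^ 2 := by
      rw [hp, ← Real.exp_nat_mul]; congr 1; push_cast; ring
    have h2 : 2 ≤ Real.exp t := by linarith [Real.add_one_le_exp t]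
    have he : p / 2 ≤ Real.sqrt (Real.exp t - 1) := by
      apply Real.le_sqrt_of_sq_le
      nlinarith
    have h3 : Real.exp t / (2 * Real.sqrt (Real.exp t - 1) ^ 3) ≤ 4 * p⁻¹ := by
      rw [hp2] at he ⊢
      have he0 : 0 < Real.sqrt (p ^ 2 - 1) := lt_of_lt_of_le (by positivity) he
      rw [div_le_iff₀ (by positivity)]
      have : (p / 2) ^ 3 ≤ Real.sqrt (p ^ 2 - 1) ^ 3 := by gcongr
      calc p ^ 2 = 4 * p⁻¹ * (2 * (p / 2) ^ 3) := by field_simp; norm_num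
        _ ≤ _ := by gcongr
    have h4 : 1 / (2 * Real.sqrt t ^ 3) ≤ t ^ (-(3 / 2) : ℝ) := by
      rw [Real.rpow_neg ht0.le, Real.sqrt_eq_rpow, ← Real.rpow_natCast, ← Real.rpow_mul ht0.le,
        one_div]
      norm_num
      have : 0 < (t ^ (3 / 2 : ℝ))⁻¹ := by positivity
      linarith
    have h5 : 0 ≤ Real.exp t / (2 * Real.sqrt (Real.exp t - 1) ^ 3) := by positivity
    have h6 : 0 ≤ 1 / (2 * Real.sqrt t ^ 3) := by positivity
    have h7 : Real.exp (-(1 / 2) * t) = p⁻¹ := by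
      rw [hp, ← Real.exp_neg]; congr 1; ring
    rw [Real.norm_eq_abs, corrDensity, h7, abs_le]
    have : 0 < p⁻¹ := by positivity
    have : 0 < t ^ (-(3 / 2) : ℝ) := by positivity
    constructor <;> linarith
  rw [← Ioc_union_Ioi_eq_Ioi zero_le_one]
  exact h1.union h2

/-- Both terms come from Laplace integrals, with densities `(exp t - 1)^(-1/2)` and `t^(-1/2)`.
Integration by parts moves the factor `j` onto the difference of the densities, whose derivative is
`corrDensity`. -/
theorem mul_centralBinom_div_sub_sqrt {j : ℕ} (hj : 1 ≤ j) :
    (j : ℝ) * (j.centralBinom / 4 ^ j) - Real.sqrt j / Real.sqrt Real.pi =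
      -Real.pi⁻¹ * ∫ t in Ioi 0, corrDensity t * Real.exp (-(j : ℝ) * t) := by
  have hj0 : 0 < (j : ℝ) := by exact_mod_cast hj
  set h : ℝ → ℝ := fun t => (Real.sqrt t)⁻¹ - (Real.sqrt (Real.exp t - 1))⁻¹ with hh
  have hi1 := integrableOn_exp_mul_inv_sqrt_id hj0
  have hi2 := integrableOn_exp_mul_inv_sqrt j
  have hi12 : IntegrableOn (fun t => j * (Real.exp (-(j : ℝ) * t) * (Real.sqrt t)⁻¹ -
      Real.exp (-(j : ℝ) * t) * (Real.sqrt (Real.exp t - 1))⁻¹)) (Ioi 0) :=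
    (hi1.sub hi2).const_mul _
  have hie : IntegrableOn (fun t => corrDensity t * Real.exp (-(j : ℝ) * t)) (Ioi 0) := by
    refine integrableOn_corrDensity.mul_bdd (c := 1) (by fun_prop) ?_
    refine (ae_restrict_iff' measurableSet_Ioi).2 (ae_of_all _ fun t ht => ?_)
    have ht : 0 < t := ht
    rw [Real.norm_eq_abs, Real.abs_exp, Real.exp_le_one_iff]
    have : 0 ≤ (j : ℝ) * t := by positivity
    linarith
  have hd : ∀ t ∈ Ioi (0 : ℝ), HasDerivAt (fun t => h t * Real.exp (-(j : ℝ) * t))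
      (corrDensity t * Real.exp (-(j : ℝ) * t) -
        j * (Real.exp (-(j : ℝ) * t) * (Real.sqrt t)⁻¹ -
          Real.exp (-(j : ℝ) * t) * (Real.sqrt (Real.exp t - 1))⁻¹)) t := by
    intro t ht
    have ht : 0 < t := ht
    have hE : 0 < Real.exp t - 1 := by linarith [Real.add_one_lt_exp ht.ne']
    have d1 := (Real.hasDerivAt_sqrt ht.ne').inv (Real.sqrt_pos.2 ht).ne'
    have d2 := (hasDerivAt_sqrt_exp_sub_one ht).inv (Real.sqrt_pos.2 hE).ne'
    have d3 : HasDerivAt (fun t => Real.exp (-(j : ℝ) * t))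
        (Real.exp (-(j : ℝ) * t) * (-(j : ℝ) * 1)) t := ((hasDerivAt_id t).const_mul _).exp
    refine ((d1.sub d2).mul d3).congr_deriv ?_
    have s1 := Real.sqrt_pos.2 ht
    have s2 := Real.sqrt_pos.2 hE
    simp only [corrDensity, Pi.sub_apply, Pi.inv_apply]
    field_simp
    ring
  have hc : ContinuousWithinAt (fun t => h t * Real.exp (-(j : ℝ) * t)) (Ici 0) 0 := by
    refine ContinuousWithinAt.mul ?_ (Continuous.continuousWithinAt (by fun_prop))
    -- The convention `0⁻¹ = 0` gives this value, and it is the true limit: the estimates below give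
    -- `|h t| ≤ √t` near `0`.
    have h00 : h 0 = 0 := by simp [hh]
    unfold ContinuousWithinAt
    rw [h00]
    have hsq : Tendsto (fun t => Real.sqrt t) (𝓝[Ici 0] 0) (𝓝 0) := by
      have := Real.continuous_sqrt.continuousWithinAt (s := Ici 0) (x := 0)
      unfold ContinuousWithinAt at this
      simpa only [Real.sqrt_zero] using this
    refine squeeze_zero_norm' ?_ hsq
    filter_upwards [self_mem_nhdsWithin, nhdsWithin_le_nhds (Iio_mem_nhds one_pos)] with t ht ht1
    rcases eq_or_lt_of_le (mem_Ici.1 ht) with h0 | ht0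
    · rw [← h0, h00]; simp
    have ht1 : t < 1 := ht1
    have hE : Real.exp t - 1 ≥ t := by linarith [Real.add_one_le_exp t]
    have hE2 : Real.exp t - 1 - t ≤ t ^ 2 := by
      have := Real.abs_exp_sub_one_sub_id_le (x := t) (by rw [abs_of_pos ht0]; exact ht1.le)
      exact (le_abs_self _).trans this
    simp only [hh]
    have hs0 : 0 < Real.sqrt t := Real.sqrt_pos.2 ht0
    have hse : Real.sqrt t ≤ Real.sqrt (Real.exp t - 1) := Real.sqrt_le_sqrt hE
    have hs2 : Real.sqrt t ^ 2 = t := Real.sq_sqrt ht0.le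
    have he2 : Real.sqrt (Real.exp t - 1) ^ 2 = Real.exp t - 1 := Real.sq_sqrt (by linarith)
    have hd := inv_anti₀ hs0 hse
    rw [Real.norm_eq_abs, abs_of_nonneg (by linarith)]
    set s := Real.sqrt t with hs
    set e := Real.sqrt (Real.exp t - 1) with he
    have he0 : 0 < e := hs0.trans_le hse
    rw [inv_sub_inv hs0.ne' he0.ne', div_le_iff₀ (by positivity)]
    have h1 : (e - s) * (e + s) ≤ s ^ 4 := by
      have : s ^ 4 = t ^ 2 := by rw [← hs2]; ring
      nlinarith
    have h2 : (e - s) * (2 * s) ≤ (e - s) * (e + s) :=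
      mul_le_mul_of_nonneg_left (by linarith) (by linarith)
    have h3 : (e - s) * s ≤ (s * (s * s)) * s := by nlinarith [pow_pos hs0 4]
    have h4 := le_of_mul_le_mul_right h3 hs0
    nlinarith [mul_pos hs0 hs0]
  have hl : Tendsto (fun t => h t * Real.exp (-(j : ℝ) * t)) atTop (𝓝 0) := by
    have h1 : Tendsto h atTop (𝓝 (0 - 0)) := by
      refine Tendsto.sub (Real.tendsto_sqrt_atTop.inv_tendsto_atTop) ?_
      exact (Real.tendsto_sqrt_atTop.comp
        (tendsto_atTop_add_const_right _ (-1) Real.tendsto_exp_atTop)).inv_tendsto_atTop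
    have h2 : Tendsto (fun t : ℝ => Real.exp (-(j : ℝ) * t)) atTop (𝓝 0) :=
      Real.tendsto_exp_atBot.comp (tendsto_id.const_mul_atTop_of_neg (by linarith))
    simpa using h1.mul h2
  have hI := integral_Ioi_of_hasDerivAt_of_tendsto hc hd
    (hie.sub hi12) hl
  have hI2 : ∫ t in Ioi (0 : ℝ), (corrDensity t * Real.exp (-(j : ℝ) * t) -
        j * (Real.exp (-(j : ℝ) * t) * (Real.sqrt t)⁻¹ -
          Real.exp (-(j : ℝ) * t) * (Real.sqrt (Real.exp t - 1))⁻¹)) =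
      (∫ t in Ioi (0 : ℝ), corrDensity t * Real.exp (-(j : ℝ) * t)) -
        j * (Real.sqrt (Real.pi / j) - Real.pi * (j.centralBinom / 4 ^ j)) := by
    rw [integral_sub hie hi12, integral_const_mul, integral_sub hi1 hi2,
      integral_exp_mul_inv_sqrt, integral_exp_mul_inv_sqrt_id hj0]
  rw [hI2] at hI
  have h00 : h 0 = 0 := by simp [hh]
  rw [h00, zero_mul, sub_zero, sub_eq_zero] at hI
  rw [hI, Real.sqrt_div Real.pi_pos.le]
  have hp : 0 < Real.sqrt Real.pi := by positivity
  have hp2 : Real.sqrt Real.pi ^ 2 = Real.pi := Real.sq_sqrt Real.pi_pos.le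
  have hq : 0 < Real.sqrt j := by positivity
  have hq2 : Real.sqrt (j : ℝ) ^ 2 = j := Real.sq_sqrt hj0.le
  have hpi := Real.pi_pos
  have e1 : (j : ℝ) * (Real.sqrt Real.pi / Real.sqrt j) = Real.sqrt j * Real.sqrt Real.pi := by
    rw [mul_div_assoc', div_eq_iff hq.ne']
    linear_combination (-Real.sqrt Real.pi) * hq2
  have e2 : Real.sqrt j / Real.sqrt Real.pi = Real.pi⁻¹ * (Real.sqrt j * Real.sqrt Real.pi) := by
    rw [div_eq_iff hp.ne']
    rw [show Real.pi⁻¹ * (Real.sqrt j * Real.sqrt Real.pi) * Real.sqrt Real.pi =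
      Real.pi⁻¹ * Real.sqrt j * Real.sqrt Real.pi ^ 2 by ring, hp2]
    field_simp
  rw [mul_sub, e1, e2]
  field_simp
  ring

/-! ### The kernel in the phase variable -/

/-- The polynomial `k_n` with `∑ k, a_k(n) (1/2+v)^k = (1/4-v^2) k_n(v)`. -/
noncomputable def kern (n : ℕ) (v : ℝ) : ℝ :=
  ∑ j ∈ Finset.Icc 1 n, weight n j * (j * j.centralBinom * (1 / 4 - v ^ 2) ^ (j - 1))

theorem continuous_kern (n : ℕ) : Continuous (kern n) := by
  unfold kern
  fun_prop

theorem kern_neg (n : ℕ) (v : ℝ) : kern n (-v) = kern n v := by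
  simp [kern]

/-- The variable in which the kernel is almost a superposition of Dirichlet kernels. -/
noncomputable def phase (v : ℝ) : ℝ := Real.sqrt (-Real.log (1 - 4 * v ^ 2))

theorem measurable_phase : Measurable phase := by
  unfold phase
  fun_prop

theorem one_sub_four_mul_sq_mem {v : ℝ} (hv : v ∈ Ioo (0 : ℝ) (1 / 2)) :
    1 - 4 * v ^ 2 ∈ Ioo (0 : ℝ) 1 := by
  constructor <;> nlinarith [hv.1, hv.2]

theorem exp_neg_phase_sq {v : ℝ} (hv : v ∈ Ioo (0 : ℝ) (1 / 2)) :
    Real.exp (-phase v ^ 2) = 1 - 4 * v ^ 2 := by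
  have h := one_sub_four_mul_sq_mem hv
  have := Real.log_neg h.1 h.2
  rw [phase, Real.sq_sqrt (by linarith), neg_neg, Real.exp_log h.1]

theorem two_mul_le_phase {v : ℝ} (hv : v ∈ Ioo (0 : ℝ) (1 / 2)) : 2 * v ≤ phase v := by
  have h := one_sub_four_mul_sq_mem hv
  have := Real.log_le_sub_one_of_pos h.1
  apply Real.le_sqrt_of_sq_le
  nlinarith

theorem phase_pos {v : ℝ} (hv : v ∈ Ioo (0 : ℝ) (1 / 2)) : 0 < phase v :=
  lt_of_lt_of_le (by linarith [hv.1]) (two_mul_le_phase hv)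

/-- The part of the kernel that comes from replacing `C(2j,j)/4^j` by `(πj)^(-1/2)`. -/
noncomputable def kernError (n : ℕ) (y : ℝ) : ℝ :=
  ∑ j ∈ Finset.Icc 1 n, weight n j *
    ((j * (j.centralBinom / 4 ^ j) - Real.sqrt j / Real.sqrt Real.pi) *
      Real.exp (-(j : ℝ) * y ^ 2))

theorem measurable_kernError (n : ℕ) : Measurable (kernError n) := by
  unfold kernError
  fun_prop

/-- Since `(4 (1/4 - v^2))^j = exp(-j y^2)` with `y = phase v`, each power becomes a Gaussian, to
which the frequency average applies once `√j / √π` is split off. -/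
theorem kern_eq (n : ℕ) {v : ℝ} (hv : v ∈ Ioo (0 : ℝ) (1 / 2)) :
    (1 / 4 - v ^ 2) * kern n v =
      Real.pi⁻¹ * (∫ k in Ioi 0, freqDensity n k * (Real.sin (2 * phase v * k) / phase v)) +
        kernError n (phase v) := by
  have hp : 0 < Real.sqrt Real.pi := by positivity
  have h1 := sum_weight_mul_sqrt_mul_exp n (phase_pos hv)
  have h2 : ∑ j ∈ Finset.Icc 1 n, weight n j *
      (Real.sqrt j * Real.exp (-(j : ℝ) * phase v ^ 2)) / Real.sqrt Real.pi =
      Real.pi⁻¹ * ∫ k in Ioi 0, freqDensity n k * (Real.sin (2 * phase v * k) / phase v) := by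
    rw [← Finset.sum_div, h1]
    conv_rhs => rw [← Real.mul_self_sqrt Real.pi_pos.le]
    field_simp
  rw [← h2, kernError, ← Finset.sum_add_distrib, kern, Finset.mul_sum]
  refine Finset.sum_congr rfl fun j hj => ?_
  have hj1 : 1 ≤ j := (Finset.mem_Icc.1 hj).1
  have he : Real.exp (-(j : ℝ) * phase v ^ 2) = 4 ^ j * (1 / 4 - v ^ 2) ^ j := by
    rw [← mul_pow, show 4 * (1 / 4 - v ^ 2) = 1 - 4 * v ^ 2 by ring, ← exp_neg_phase_sq hv,
      ← Real.exp_nat_mul]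
    ring_nf
  rw [he]
  obtain ⟨m, rfl⟩ : ∃ m, j = m + 1 := ⟨j - 1, by omega⟩
  rw [Nat.add_sub_cancel, pow_succ (1 / 4 - v ^ 2)]
  field_simp
  ring

/-- The weighted sum inside is the Bessel average at `y^2 + t`, bounded by `1` when `n ≥ 1` and
tending to `0` for `t > 0`. Dominated convergence against `corrDensity` then controls the error. -/
theorem kernError_eq (n : ℕ) (y : ℝ) :
    kernError n y = -Real.pi⁻¹ * ∫ t in Ioi 0, corrDensity t *
      ∑ j ∈ Finset.Icc 1 n, weight n j * Real.exp (-(j : ℝ) * (y ^ 2 + t)) := by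
  have hi : ∀ j ∈ Finset.Icc 1 n, IntegrableOn (fun t => weight n j * Real.exp (-(j : ℝ) * y ^ 2) *
      (corrDensity t * Real.exp (-(j : ℝ) * t))) (Ioi 0) := by
    intro j _
    refine Integrable.const_mul ?_ _
    refine integrableOn_corrDensity.mul_bdd (c := 1) (by fun_prop) ?_
    refine (ae_restrict_iff' measurableSet_Ioi).2 (ae_of_all _ fun t ht => ?_)
    have ht : 0 < t := ht
    rw [Real.norm_eq_abs, Real.abs_exp, Real.exp_le_one_iff]
    have : 0 ≤ (j : ℝ) * t := by positivity
    linarith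
  have h : ∀ t, corrDensity t * ∑ j ∈ Finset.Icc 1 n, weight n j *
      Real.exp (-(j : ℝ) * (y ^ 2 + t)) = ∑ j ∈ Finset.Icc 1 n,
        weight n j * Real.exp (-(j : ℝ) * y ^ 2) *
          (corrDensity t * Real.exp (-(j : ℝ) * t)) := by
    intro t
    rw [Finset.mul_sum]
    refine Finset.sum_congr rfl fun j _ => ?_
    rw [mul_add, Real.exp_add]
    ring
  simp_rw [h]
  rw [integral_finsetSum _ hi, Finset.mul_sum, kernError]
  refine Finset.sum_congr rfl fun j hj => ?_
  rw [mul_centralBinom_div_sub_sqrt (Finset.mem_Icc.1 hj).1, integral_const_mul]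
  ring

theorem abs_kernError_le {n : ℕ} (hn : 1 ≤ n) (y : ℝ) :
    |kernError n y| ≤ Real.pi⁻¹ * ∫ t in Ioi 0, |corrDensity t| := by
  rw [kernError_eq, abs_mul, abs_neg, abs_of_pos (inv_pos.2 Real.pi_pos)]
  refine mul_le_mul_of_nonneg_left ?_ (inv_pos.2 Real.pi_pos).le
  rw [← Real.norm_eq_abs]
  refine norm_integral_le_of_norm_le integrableOn_corrDensity.abs ?_
  refine (ae_restrict_iff' measurableSet_Ioi).2 (ae_of_all _ fun t ht => ?_)
  have ht : 0 < t := ht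
  rw [norm_mul, Real.norm_eq_abs, Real.norm_eq_abs]
  exact mul_le_of_le_one_right (abs_nonneg _) (abs_sum_weight_mul_exp_le hn (by positivity))

theorem tendsto_kernError (y : ℝ) : Tendsto (fun n => kernError n y) atTop (𝓝 0) := by
  simp_rw [fun n => kernError_eq n y]
  suffices h : Tendsto (fun n => ∫ t in Ioi 0, corrDensity t *
      ∑ j ∈ Finset.Icc 1 n, weight n j * Real.exp (-(j : ℝ) * (y ^ 2 + t))) atTop
      (𝓝 (∫ t in Ioi (0 : ℝ), (0 : ℝ))) by
    simpa only [integral_zero, mul_zero] using h.const_mul (-Real.pi⁻¹)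
  refine tendsto_integral_filter_of_dominated_convergence (fun t => |corrDensity t|) ?_ ?_
    integrableOn_corrDensity.abs ?_
  · refine Eventually.of_forall fun n => ?_
    exact integrableOn_corrDensity.aestronglyMeasurable.mul (by fun_prop)
  · refine eventually_atTop.2 ⟨1, fun n hn => ?_⟩
    refine (ae_restrict_iff' measurableSet_Ioi).2 (ae_of_all _ fun t ht => ?_)
    have ht : 0 < t := ht
    rw [norm_mul, Real.norm_eq_abs, Real.norm_eq_abs]
    exact mul_le_of_le_one_right (abs_nonneg _) (abs_sum_weight_mul_exp_le hn (by positivity))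
  · refine (ae_restrict_iff' measurableSet_Ioi).2 (ae_of_all _ fun t ht => ?_)
    have ht : 0 < t := ht
    have := (tendsto_sum_weight_mul_exp (c := y ^ 2 + t) (by positivity)).const_mul (corrDensity t)
    rwa [mul_zero] at this

/-! ### Negligible functions -/

/-- A first moment is what Fubini needs, the bound on `sin(2yk)/y` uniform in `y` being `2|k|`. -/
theorem integrableOn_mul_freqDensity (n : ℕ) :
    IntegrableOn (fun k => freqDensity n k * k) (Ioi 0) := by
  refine integrableOn_freqDensity_mul n fun B hB => ?_
  have h := (integrable_rpow_mul_exp_neg_mul_sq hB (s := 2) (by norm_num)).integrableOn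
    (s := Ioi 0)
  refine h.congr (ae_of_all _ fun k => ?_)
  simp only [Real.rpow_two]
  ring

/-- The truncated Fourier-type functional `∫ ψ(v) sin(2ky)/y dv` with `y = phase v`. -/
noncomputable def sineTransform (s : Set ℝ) (ψ : ℝ → ℝ) (k : ℝ) : ℝ :=
  ∫ v in s, ψ v * (Real.sin (2 * phase v * k) / phase v)

/-- A sufficient condition on `ψ` for `∫ ψ (1/4-v^2) k_n → 0`. -/
structure Negligible (s : Set ℝ) (ψ : ℝ → ℝ) : Prop where
  integrableOn : IntegrableOn ψ s
  bounded : ∃ M, ∀ k ∈ Ioi (0 : ℝ), |sineTransform s ψ k| ≤ M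
  tendsto : Tendsto (sineTransform s ψ) atTop (𝓝 0)

theorem abs_sin_div_phase_le (y k : ℝ) : |Real.sin (2 * y * k) / y| ≤ 2 * |k| := by
  rcases eq_or_ne y 0 with rfl | hy
  · simp
  · rw [abs_div, div_le_iff₀ (abs_pos.2 hy)]
    refine (Real.abs_sin_le_abs).trans (le_of_eq ?_)
    rw [abs_mul, abs_mul, abs_two]
    ring

theorem integrableOn_mul_sin_div_phase {s : Set ℝ} {ψ : ℝ → ℝ} (h : IntegrableOn ψ s) (k : ℝ) :
    IntegrableOn (fun v => ψ v * (Real.sin (2 * phase v * k) / phase v)) s := by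
  have hp := measurable_phase
  refine h.mul_bdd (c := 2 * |k|) ?_ (ae_of_all _ fun v => abs_sin_div_phase_le _ _)
  exact Measurable.aestronglyMeasurable (by fun_prop)

theorem Negligible.add {s : Set ℝ} {ψ φ : ℝ → ℝ} (h : Negligible s ψ) (h' : Negligible s φ) :
    Negligible s (fun v => ψ v + φ v) := by
  have he : ∀ k, sineTransform s (fun v => ψ v + φ v) k =
      sineTransform s ψ k + sineTransform s φ k := by
    intro k
    unfold sineTransform
    rw [← integral_add (integrableOn_mul_sin_div_phase h.1 k)
      (integrableOn_mul_sin_div_phase h'.1 k)]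
    simp only [add_mul]
  obtain ⟨M, hM⟩ := h.2
  obtain ⟨M', hM'⟩ := h'.2
  refine ⟨h.1.add h'.1, ⟨M + M', fun k hk => ?_⟩, ?_⟩
  · rw [he]
    exact (abs_add_le _ _).trans (add_le_add (hM k hk) (hM' k hk))
  · have := h.3.add h'.3
    rw [add_zero] at this
    exact this.congr fun k => (he k).symm

theorem Negligible.const_mul {s : Set ℝ} {ψ : ℝ → ℝ} (h : Negligible s ψ) (c : ℝ) :
    Negligible s (fun v => c * ψ v) := by
  have he : ∀ k, sineTransform s (fun v => c * ψ v) k = c * sineTransform s ψ k := by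
    intro k
    unfold sineTransform
    rw [← integral_const_mul]
    simp only [mul_assoc]
  obtain ⟨M, hM⟩ := h.2
  refine ⟨h.1.const_mul c, ⟨|c| * M, fun k hk => ?_⟩, ?_⟩
  · rw [he, abs_mul]
    exact mul_le_mul_of_nonneg_left (hM k hk) (abs_nonneg _)
  · have := h.3.const_mul c
    rw [mul_zero] at this
    exact this.congr fun k => (he k).symm

theorem Negligible.congr {s : Set ℝ} (hs : MeasurableSet s) {ψ φ : ℝ → ℝ} (h : Negligible s ψ)
    (hc : EqOn ψ φ s) : Negligible s φ := by
  have he : ∀ k, sineTransform s ψ k = sineTransform s φ k := fun k =>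
    setIntegral_congr_fun hs fun v hv => by simp only [hc hv]
  obtain ⟨M, hM⟩ := h.2
  exact ⟨h.1.congr_fun hc hs, ⟨M, fun k hk => he k ▸ hM k hk⟩, h.3.congr he⟩

/-- By Fubini the main part of the integral is the average of the sine transform over the escaping
density; the error part tends to `0` by dominated convergence. -/
theorem Negligible.tendsto_integral {s : Set ℝ} (hs : MeasurableSet s)
    (hs' : s ⊆ Ioo (0 : ℝ) (1 / 2)) {ψ : ℝ → ℝ} (h : Negligible s ψ) :
    Tendsto (fun n => ∫ v in s, ψ v * ((1 / 4 - v ^ 2) * kern n v)) atTop (𝓝 0) := by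
  obtain ⟨M, hM⟩ := h.bounded
  have hp := measurable_phase
  set C := Real.pi⁻¹ * ∫ t in Ioi 0, |corrDensity t|
  have hprod : ∀ n, Integrable (fun p : ℝ × ℝ =>
      ψ p.1 * (freqDensity n p.2 * (Real.sin (2 * phase p.1 * p.2) / phase p.1)))
      ((volume.restrict s).prod (volume.restrict (Ioi 0))) := by
    intro n
    have hb := (h.integrableOn.mul_prod (integrableOn_mul_freqDensity n)).norm.const_mul 2
    refine hb.mono' ?_ (ae_of_all _ fun p => ?_)
    · refine (h.integrableOn.aestronglyMeasurable.comp_fst).mul ?_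
      have := (continuous_freqDensity n).measurable
      exact Measurable.aestronglyMeasurable (by fun_prop)
    · simp only [norm_mul, Real.norm_eq_abs]
      have h1 := abs_sin_div_phase_le (phase p.1) p.2
      calc |ψ p.1| * (|freqDensity n p.2| * |Real.sin (2 * phase p.1 * p.2) / phase p.1|)
          ≤ |ψ p.1| * (|freqDensity n p.2| * (2 * |p.2|)) := by gcongr
        _ = 2 * (|ψ p.1| * (|freqDensity n p.2| * |p.2|)) := by ring
  have herr : ∀ n, 1 ≤ n → IntegrableOn (fun v => ψ v * kernError n (phase v)) s := by
    intro n hn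
    refine h.integrableOn.mul_bdd (c := C) ?_ (ae_of_all _ fun v => abs_kernError_le hn _)
    exact ((measurable_kernError n).comp hp).aestronglyMeasurable
  have hsplit : ∀ n, 1 ≤ n → ∫ v in s, ψ v * ((1 / 4 - v ^ 2) * kern n v) =
      Real.pi⁻¹ * (∫ k in Ioi 0, freqDensity n k * sineTransform s ψ k) +
        ∫ v in s, ψ v * kernError n (phase v) := by
    intro n hn
    have h1 : ∫ v in s, ψ v * ((1 / 4 - v ^ 2) * kern n v) =
        ∫ v in s, (Real.pi⁻¹ * (∫ k in Ioi 0, ψ v * (freqDensity n k *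
          (Real.sin (2 * phase v * k) / phase v))) + ψ v * kernError n (phase v)) := by
      refine setIntegral_congr_fun hs fun v hv => ?_
      rw [kern_eq n (hs' hv), integral_const_mul]
      ring
    rw [h1, integral_add ((hprod n).integral_prod_left.const_mul _) (herr n hn),
      integral_const_mul, integral_integral_swap (hprod n)]
    congr 2
    refine integral_congr_ae (ae_of_all _ fun k => ?_)
    simp only [sineTransform]
    rw [← integral_const_mul]
    refine integral_congr_ae (ae_of_all _ fun v => ?_)
    simp only
    ring
  have hA := (tendsto_integral_freqDensity_mul hM h.tendsto).const_mul Real.pi⁻¹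
  have hB : Tendsto (fun n => ∫ v in s, ψ v * kernError n (phase v)) atTop (𝓝 0) := by
    rw [← integral_zero ℝ ℝ (μ := volume.restrict s)]
    refine tendsto_integral_filter_of_dominated_convergence (fun v => |ψ v| * C) ?_ ?_
      (h.integrableOn.abs.mul_const C) ?_
    · exact eventually_atTop.2 ⟨1, fun n hn => (herr n hn).aestronglyMeasurable⟩
    · refine eventually_atTop.2 ⟨1, fun n hn => ae_of_all _ fun v => ?_⟩
      rw [norm_mul, Real.norm_eq_abs, Real.norm_eq_abs]
      exact mul_le_mul_of_nonneg_left (abs_kernError_le hn _) (abs_nonneg _)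
    · refine ae_of_all _ fun v => ?_
      have := (tendsto_kernError (phase v)).const_mul (ψ v)
      rwa [mul_zero] at this
  have := hA.add hB
  rw [mul_zero, add_zero] at this
  exact this.congr' (eventually_atTop.2 ⟨1, fun n hn => (hsplit n hn).symm⟩)

/-! ### The phase as a coordinate, and Dini's criterion -/

/-- The inverse of `phase`. -/
noncomputable def phaseInv (y : ℝ) : ℝ := Real.sqrt (1 - Real.exp (-y ^ 2)) / 2

theorem one_sub_exp_neg_sq_pos {y : ℝ} (hy : 0 < y) : 0 < 1 - Real.exp (-y ^ 2) := by
  have : Real.exp (-y ^ 2) < 1 := by rw [Real.exp_lt_one_iff]; nlinarith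
  linarith

theorem phase_phaseInv {y : ℝ} (hy : 0 ≤ y) : phase (phaseInv y) = y := by
  have h : 0 ≤ 1 - Real.exp (-y ^ 2) := by
    have : Real.exp (-y ^ 2) ≤ 1 := by rw [Real.exp_le_one_iff]; nlinarith
    linarith
  unfold phase phaseInv
  rw [div_pow, Real.sq_sqrt h]
  have : 1 - 4 * ((1 - Real.exp (-y ^ 2)) / 2 ^ 2) = Real.exp (-y ^ 2) := by ring
  rw [this, Real.log_exp, neg_neg, Real.sqrt_sq hy]

theorem phaseInv_mem {y : ℝ} (hy : 0 < y) : phaseInv y ∈ Ioo (0 : ℝ) (1 / 2) := by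
  have h := one_sub_exp_neg_sq_pos hy
  have h2 := Real.exp_pos (-y ^ 2)
  have h3 : Real.sqrt (1 - Real.exp (-y ^ 2)) < 1 := by
    rw [Real.sqrt_lt' one_pos]; linarith
  have h4 := Real.sqrt_pos.2 h
  unfold phaseInv
  constructor <;> linarith

theorem phaseInv_phase {v : ℝ} (hv : v ∈ Ioo (0 : ℝ) (1 / 2)) : phaseInv (phase v) = v := by
  unfold phaseInv
  rw [exp_neg_phase_sq hv, show 1 - (1 - 4 * v ^ 2) = (2 * v) ^ 2 by ring,
    Real.sqrt_sq (by linarith [hv.1])]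
  ring

theorem strictMonoOn_phaseInv : StrictMonoOn phaseInv (Ici 0) := by
  intro a ha b _ hab
  have ha : 0 ≤ a := ha
  have : Real.exp (-b ^ 2) < Real.exp (-a ^ 2) := by rw [Real.exp_lt_exp]; nlinarith
  unfold phaseInv
  have h : 0 ≤ 1 - Real.exp (-a ^ 2) := by
    have : Real.exp (-a ^ 2) ≤ 1 := by rw [Real.exp_le_one_iff]; nlinarith
    linarith
  have := Real.sqrt_lt_sqrt h (by linarith : 1 - Real.exp (-a ^ 2) < 1 - Real.exp (-b ^ 2))
  linarith

theorem image_phaseInv_Ioi : phaseInv '' Ioi 0 = Ioo (0 : ℝ) (1 / 2) := by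
  ext v
  constructor
  · rintro ⟨y, hy, rfl⟩
    exact phaseInv_mem hy
  · intro hv
    exact ⟨phase v, phase_pos hv, phaseInv_phase hv⟩

/-- The derivative of `phaseInv`. -/
noncomputable def phaseInvDeriv (y : ℝ) : ℝ :=
  y * Real.exp (-y ^ 2) / (2 * Real.sqrt (1 - Real.exp (-y ^ 2)))

theorem hasDerivAt_phaseInv {y : ℝ} (hy : 0 < y) : HasDerivAt phaseInv (phaseInvDeriv y) y := by
  have h := one_sub_exp_neg_sq_pos hy
  have h1 : HasDerivAt (fun y : ℝ => -y ^ 2) (-(2 * y)) y := by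
    simpa using! (hasDerivAt_pow 2 y).neg
  refine ((((h1.exp).const_sub 1).sqrt h.ne').div_const 2).congr_deriv ?_
  unfold phaseInvDeriv
  have := Real.sqrt_pos.2 h
  field_simp

/-- With `E = exp(-y^2)` and `s = √(1 - E)`, the inequalities `yE ≤ s ≤ y` place the derivative
between `E/2` and `1/2`, and `E ≥ 1 - y^2`. The quadratic error absorbs the factor `1/y` of the sine
kernel. -/
theorem abs_phaseInvDeriv_sub_half_le {y : ℝ} (hy : 0 < y) :
    0 < phaseInvDeriv y ∧ |phaseInvDeriv y - 1 / 2| ≤ y ^ 2 / 2 := by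
  have h := one_sub_exp_neg_sq_pos hy
  have hs := Real.sqrt_pos.2 h
  have hE := Real.exp_pos (-y ^ 2)
  have h1 : 1 - y ^ 2 ≤ Real.exp (-y ^ 2) := by linarith [Real.add_one_le_exp (-y ^ 2)]
  have hpos : 0 < phaseInvDeriv y := by unfold phaseInvDeriv; positivity
  refine ⟨hpos, ?_⟩
  set s := Real.sqrt (1 - Real.exp (-y ^ 2)) with hs_def
  have hs2 : s ^ 2 = 1 - Real.exp (-y ^ 2) := Real.sq_sqrt h.le
  set E := Real.exp (-y ^ 2) with hE_def
  have hsy : s ≤ y := by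
    rw [hs_def, Real.sqrt_le_left hy.le]; linarith
  have hEy : y * E ≤ s := by
    apply Real.le_sqrt_of_sq_le
    have hp : Real.exp (y ^ 2) * E = 1 := by rw [hE_def, ← Real.exp_add]; simp
    have h2 : y ^ 2 + 1 ≤ Real.exp (y ^ 2) := Real.add_one_le_exp _
    have h3 : (y ^ 2 + 1) * E ≤ 1 :=
      (mul_le_mul_of_nonneg_right h2 hE.le).trans hp.le
    have hE1 : E ≤ 1 := by linarith
    have : y ^ 2 * E ≤ 1 - E := by linarith
    nlinarith [mul_nonneg (sq_nonneg y) hE.le]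
  have hval : phaseInvDeriv y = y * E / (2 * s) := rfl
  rw [hval, abs_le]
  constructor
  · have : E / 2 ≤ y * E / (2 * s) := by
      rw [le_div_iff₀ (by positivity)]
      nlinarith
    linarith
  · have : y * E / (2 * s) ≤ 1 / 2 := by
      rw [div_le_iff₀ (by positivity)]
      linarith
    have := sq_nonneg y
    linarith

/-- Riemann–Lebesgue in the variable `y`; the Jacobian is absorbed into the integrable function. -/
theorem tendsto_integral_mul_sin_phase {f : ℝ → ℝ} (hf : IntegrableOn f (Ioo 0 (1 / 2))) :
    Tendsto (fun k => ∫ v in Ioo 0 (1 / 2), f v * Real.sin (2 * phase v * k)) atTop (𝓝 0) := by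
  have hd : ∀ y ∈ Ioi (0 : ℝ), HasDerivWithinAt phaseInv (phaseInvDeriv y) (Ioi 0) y :=
    fun y hy => (hasDerivAt_phaseInv hy).hasDerivWithinAt
  have hinj : InjOn phaseInv (Ioi 0) := strictMonoOn_phaseInv.injOn.mono Ioi_subset_Ici_self
  rw [← image_phaseInv_Ioi,
    integrableOn_image_iff_integrableOn_abs_deriv_smul measurableSet_Ioi hd hinj] at hf
  refine (tendsto_integral_mul_cos _ measurableSet_Ioi _ hf).2.congr fun k => ?_
  rw [← image_phaseInv_Ioi,
    integral_image_eq_integral_abs_deriv_smul measurableSet_Ioi hd hinj]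
  refine setIntegral_congr_fun measurableSet_Ioi fun y hy => ?_
  have hy : 0 < y := hy
  simp only [smul_eq_mul, phase_phaseInv hy.le]
  rw [show 2 * k * y = 2 * y * k by ring, mul_assoc]

/-- Because `phase v ≥ 2v`, the quotient of `ψ` by `phase` is integrable too, and the sine transform
is an ordinary oscillatory integral. -/
theorem negligible_of_integrableOn_div {s : Set ℝ} (hs : MeasurableSet s)
    (hs' : s ⊆ Ioo (0 : ℝ) (1 / 2)) {ψ : ℝ → ℝ} (h : IntegrableOn (fun v => ψ v * v⁻¹) s) :
    Negligible s ψ := by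
  have hp := measurable_phase
  have hψ : IntegrableOn ψ s := by
    have h1 : IntegrableOn (fun v => ψ v * v⁻¹ * v) s := by
      refine h.mul_bdd (c := 1) measurable_id.aestronglyMeasurable
        ((ae_restrict_iff' hs).2 (ae_of_all _ fun v hv => ?_))
      have := hs' hv
      rw [Real.norm_eq_abs, abs_of_pos this.1]
      linarith [this.2]
    refine h1.congr_fun (fun v hv => ?_) hs
    have := (hs' hv).1
    field_simp
  have hψp : IntegrableOn (fun v => ψ v * (phase v)⁻¹) s := by
    refine h.norm.mono' (hψ.aestronglyMeasurable.mul
      (Measurable.aestronglyMeasurable (by fun_prop)))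
      ((ae_restrict_iff' hs).2 (ae_of_all _ fun v hv => ?_))
    have h1 := two_mul_le_phase (hs' hv)
    have h0 := (hs' hv).1
    rw [norm_mul, norm_mul, norm_inv, norm_inv, Real.norm_eq_abs, Real.norm_eq_abs,
      Real.norm_eq_abs, abs_of_pos (phase_pos (hs' hv)), abs_of_pos h0]
    gcongr
    linarith
  have heq : ∀ k, sineTransform s ψ k =
      ∫ v in s, ψ v * (phase v)⁻¹ * Real.sin (2 * phase v * k) := by
    intro k
    unfold sineTransform
    congr 1
    ext v
    ring
  refine ⟨hψ, ⟨∫ v in s, ‖ψ v * (phase v)⁻¹‖, fun k _ => ?_⟩, ?_⟩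
  · rw [heq, ← Real.norm_eq_abs]
    refine norm_integral_le_of_norm_le hψp.norm (ae_of_all _ fun v => ?_)
    rw [norm_mul _ (Real.sin _)]
    exact mul_le_of_le_one_right (norm_nonneg _) (Real.abs_sin_le_one _)
  · have hind : IntegrableOn (s.indicator fun v => ψ v * (phase v)⁻¹) (Ioo 0 (1 / 2)) :=
      ((integrable_indicator_iff hs).2 hψp).integrableOn
    refine (tendsto_integral_mul_sin_phase hind).congr fun k => ?_
    rw [heq, ← integral_indicator measurableSet_Ioo, ← integral_indicator hs]
    congr 1
    ext v
    by_cases hv : v ∈ s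
    · rw [indicator_of_mem (hs' hv), indicator_of_mem hv, indicator_of_mem hv]
    · by_cases hv' : v ∈ Ioo (0 : ℝ) (1 / 2)
      · rw [indicator_of_mem hv', indicator_of_notMem hv, indicator_of_notMem hv, zero_mul]
      · rw [indicator_of_notMem hv', indicator_of_notMem hv]

/-! ### Jordan's criterion -/

theorem intervalIntegrable_sin_div (k A B : ℝ) :
    IntervalIntegrable (fun y => Real.sin (2 * y * k) / y) volume A B := by
  have hb : IntervalIntegrable (fun _ : ℝ => 2 * |k|) volume A B := intervalIntegrable_const
  refine hb.mono_fun (Measurable.aestronglyMeasurable (by fun_prop)) (ae_of_all _ fun y => ?_)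
  exact (abs_sin_div_phase_le y k).trans (le_abs_self _)

theorem abs_integral_sin_div_le {k : ℝ} (hk : 0 < k) {A B : ℝ} (hA : 0 ≤ A) (hAB : A ≤ B) :
    |∫ y in A..B, Real.sin (2 * y * k) / y| ≤ 4 := by
  have hδ : 0 < 1 / (2 * k) := by positivity
  -- Below `1/(2k)` the integrand is at most `2k`, giving the bound `1`. Above it, integration by
  -- parts leaves two boundary terms and an integral of `1/(2ky^2)`, each at most `1`.
  have hsmall : ∀ A B : ℝ, 0 ≤ A → A ≤ B → B ≤ 1 / (2 * k) →
      |∫ y in A..B, Real.sin (2 * y * k) / y| ≤ 1 := by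
    intro A B hA hAB hB
    have h := intervalIntegral.norm_integral_le_of_norm_le_const (a := A) (b := B)
      (f := fun y => Real.sin (2 * y * k) / y) (C := 2 * |k|)
      fun y _ => abs_sin_div_phase_le y k
    rw [Real.norm_eq_abs, abs_of_nonneg (by linarith : 0 ≤ B - A), abs_of_pos hk] at h
    refine h.trans ?_
    have : 2 * k * (B - A) ≤ 2 * k * (1 / (2 * k)) := by gcongr; linarith
    refine this.trans (le_of_eq ?_)
    field_simp
  have hlarge : ∀ A B : ℝ, 1 / (2 * k) ≤ A → A ≤ B →
      |∫ y in A..B, Real.sin (2 * y * k) / y| ≤ 3 := by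
    intro A B hA hAB
    have hA0 : 0 < A := hδ.trans_le hA
    have hpos : ∀ y ∈ uIcc A B, 0 < y := by
      intro y hy
      rw [uIcc_of_le hAB] at hy
      exact hA0.trans_le hy.1
    have hci : IntervalIntegrable (fun y => Real.cos (2 * y * k) / (2 * k * y ^ 2)) volume A B := by
      apply ContinuousOn.intervalIntegrable
      refine ContinuousOn.div (by fun_prop) (by fun_prop) fun y hy => ?_
      have := hpos y hy
      positivity
    have hii : IntervalIntegrable (fun y => 1 / (2 * k * y ^ 2)) volume A B := by
      apply ContinuousOn.intervalIntegrable
      refine ContinuousOn.div (by fun_prop) (by fun_prop) fun y hy => ?_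
      have := hpos y hy
      positivity
    have h1 : ∫ y in A..B, (Real.sin (2 * y * k) / y + Real.cos (2 * y * k) / (2 * k * y ^ 2)) =
        -Real.cos (2 * B * k) / (2 * k * B) - -Real.cos (2 * A * k) / (2 * k * A) := by
      refine intervalIntegral.integral_eq_sub_of_hasDerivAt
        (f := fun y => -Real.cos (2 * y * k) / (2 * k * y)) (fun y hy => ?_)
        ((intervalIntegrable_sin_div k A B).add hci)
      have hy := hpos y hy
      have d1 : HasDerivAt (fun y : ℝ => Real.cos (2 * y * k))
          (-Real.sin (2 * y * k) * (2 * 1 * k)) y :=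
        (((hasDerivAt_id y).const_mul 2).mul_const k).cos
      have d2 : HasDerivAt (fun y : ℝ => 2 * k * y) (2 * k * 1) y :=
        (hasDerivAt_id y).const_mul _
      refine (d1.neg.div d2 (by positivity)).congr_deriv ?_
      simp only [Pi.neg_apply]
      field_simp
      ring
    have h2 : ∫ y in A..B, 1 / (2 * k * y ^ 2) = -1 / (2 * k * B) - -1 / (2 * k * A) := by
      refine intervalIntegral.integral_eq_sub_of_hasDerivAt
        (f := fun y => -1 / (2 * k * y)) (fun y hy => ?_) hii
      have hy := hpos y hy
      have d2 : HasDerivAt (fun y : ℝ => 2 * k * y) (2 * k * 1) y :=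
        (hasDerivAt_id y).const_mul _
      refine ((hasDerivAt_const y (-1 : ℝ)).div d2 (by positivity)).congr_deriv ?_
      field_simp
      ring
    rw [intervalIntegral.integral_add (intervalIntegrable_sin_div k A B) hci] at h1
    have h3 : |∫ y in A..B, Real.cos (2 * y * k) / (2 * k * y ^ 2)| ≤
        ∫ y in A..B, 1 / (2 * k * y ^ 2) := by
      rw [← Real.norm_eq_abs]
      refine intervalIntegral.norm_integral_le_of_norm_le (μ := volume) hAB
        (ae_of_all _ fun y hy => ?_) hii
      have hy : 0 < y := hA0.trans hy.1
      rw [Real.norm_eq_abs, abs_div, abs_of_pos (by positivity : 0 < 2 * k * y ^ 2)]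
      gcongr
      exact Real.abs_cos_le_one _
    have hB0 : 0 < B := hA0.trans_le hAB
    have hcb : ∀ y : ℝ, 1 / (2 * k) ≤ y → |-Real.cos (2 * y * k) / (2 * k * y)| ≤ 1 ∧
        1 / (2 * k * y) ≤ 1 ∧ 0 ≤ 1 / (2 * k * y) := by
      intro y hy
      have hy0 : 0 < y := hδ.trans_le hy
      have h1 : 1 ≤ 2 * k * y := by
        have : 2 * k * (1 / (2 * k)) ≤ 2 * k * y := by gcongr
        rwa [mul_one_div_cancel (by positivity)] at this
      refine ⟨?_, ?_, by positivity⟩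
      · rw [abs_div, abs_neg, abs_of_pos (by positivity : 0 < 2 * k * y)]
        exact div_le_one_of_le₀ ((Real.abs_cos_le_one _).trans h1) (by positivity)
      · exact div_le_one_of_le₀ h1 (by positivity)
    have cA := hcb A hA
    have cB := hcb B (hA.trans hAB)
    rw [h2, neg_div, neg_div] at h3
    rw [abs_le] at h3
    have := abs_le.1 cA.1
    have := abs_le.1 cB.1
    rw [abs_le]
    constructor <;> linarith [cA.2.1, cA.2.2, cB.2.1, cB.2.2, h3.1, h3.2]
  rcases le_total B (1 / (2 * k)) with h | h
  · linarith [hsmall A B hA hAB h]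
  rcases le_total (1 / (2 * k)) A with h' | h'
  · linarith [hlarge A B h' hAB]
  rw [← intervalIntegral.integral_add_adjacent_intervals
    (intervalIntegrable_sin_div k A (1 / (2 * k))) (intervalIntegrable_sin_div k _ B)]
  refine (abs_add_le _ _).trans ?_
  linarith [hsmall A _ hA h' le_rfl, hlarge _ B le_rfl h]

theorem monotoneOn_phase : MonotoneOn phase (Ico 0 (1 / 2)) := by
  intro a ha b hb hab
  unfold phase
  apply Real.sqrt_le_sqrt
  apply neg_le_neg
  apply Real.log_le_log
  · nlinarith [hb.1, hb.2]
  · nlinarith [ha.1]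

/-- In the variable `y` the Jacobian is `1/2 + O(y^2)`: the constant part contributes at most `4/2`,
the rest has a bounded integrand on a bounded interval. The bound is uniform in the interval and in
`k`. -/
theorem abs_sineTransform_Ioo_le {k : ℝ} (hk : 0 < k) {α β b : ℝ} (hα : 0 ≤ α) (hαβ : α ≤ β)
    (hβ : β ≤ b) (hb : b < 1 / 2) :
    |sineTransform (Ioo α β) (fun _ => 1) k| ≤ 2 + phase b ^ 2 := by
  have hαm : α ∈ Ico (0 : ℝ) (1 / 2) := ⟨hα, by linarith⟩
  have hβm : β ∈ Ico (0 : ℝ) (1 / 2) := ⟨by linarith, by linarith⟩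
  have hbm : b ∈ Ico (0 : ℝ) (1 / 2) := ⟨by linarith, by linarith⟩
  have hp0 : phase 0 = 0 := by simp [phase]
  have hinv : ∀ v ∈ Ico (0 : ℝ) (1 / 2), phaseInv (phase v) = v := by
    intro v hv
    rcases eq_or_lt_of_le hv.1 with h | h
    · rw [← h, hp0]; simp [phaseInv]
    · exact phaseInv_phase ⟨h, hv.2⟩
  have hnn : ∀ v, 0 ≤ phase v := fun v => Real.sqrt_nonneg _
  have hAB := monotoneOn_phase hαm hβm hαβ
  have hBb := monotoneOn_phase hβm hbm hβ
  have himg : phaseInv '' Ioo (phase α) (phase β) = Ioo α β := by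
    ext v
    constructor
    · rintro ⟨y, hy, rfl⟩
      have hy0 : 0 ≤ y := (hnn _).trans hy.1.le
      have h1 := strictMonoOn_phaseInv (mem_Ici.2 (hnn α)) (mem_Ici.2 hy0) hy.1
      have h2 := strictMonoOn_phaseInv (mem_Ici.2 hy0) (mem_Ici.2 (hnn β)) hy.2
      rw [hinv α hαm] at h1
      rw [hinv β hβm] at h2
      exact ⟨h1, h2⟩
    · intro hv
      have hvm : v ∈ Ico (0 : ℝ) (1 / 2) := ⟨hα.trans hv.1.le, hv.2.trans hβm.2⟩
      refine ⟨phase v, ⟨?_, ?_⟩, hinv v hvm⟩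
      · rw [← strictMonoOn_phaseInv.lt_iff_lt (mem_Ici.2 (hnn α)) (mem_Ici.2 (hnn v)),
          hinv α hαm, hinv v hvm]
        exact hv.1
      · rw [← strictMonoOn_phaseInv.lt_iff_lt (mem_Ici.2 (hnn v)) (mem_Ici.2 (hnn β)),
          hinv β hβm, hinv v hvm]
        exact hv.2
  have hpos : ∀ y ∈ Ioo (phase α) (phase β), 0 < y := fun y hy => (hnn _).trans_lt hy.1
  unfold sineTransform
  rw [← himg, integral_image_eq_integral_abs_deriv_smul measurableSet_Ioo
    (fun y hy => (hasDerivAt_phaseInv (hpos y hy)).hasDerivWithinAt)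
    (strictMonoOn_phaseInv.injOn.mono fun y hy => (hpos y hy).le)]
  have h1 : ∫ y in Ioo (phase α) (phase β), |phaseInvDeriv y| • ((1 : ℝ) *
      (Real.sin (2 * phase (phaseInv y) * k) / phase (phaseInv y))) =
      ∫ y in Ioo (phase α) (phase β), (1 / 2 * (Real.sin (2 * y * k) / y) +
        (phaseInvDeriv y - 1 / 2) * (Real.sin (2 * y * k) / y)) := by
    refine setIntegral_congr_fun measurableSet_Ioo fun y hy => ?_
    have hy := hpos y hy
    simp only [smul_eq_mul, phase_phaseInv hy.le, one_mul]
    rw [abs_of_pos (abs_phaseInvDeriv_sub_half_le hy).1]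
    ring
  have hi1 : IntegrableOn (fun y => Real.sin (2 * y * k) / y) (Ioo (phase α) (phase β)) := by
    rw [← integrableOn_Ioc_iff_integrableOn_Ioo,
      ← intervalIntegrable_iff_integrableOn_Ioc_of_le hAB]
    exact intervalIntegrable_sin_div k _ _
  have hbd : ∀ y ∈ Ioo (phase α) (phase β),
      ‖(phaseInvDeriv y - 1 / 2) * (Real.sin (2 * y * k) / y)‖ ≤ phase β / 2 := by
    intro y hy
    have hy0 := hpos y hy
    rw [norm_mul, Real.norm_eq_abs, Real.norm_eq_abs, abs_div, abs_of_pos hy0]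
    calc |phaseInvDeriv y - 1 / 2| * (|Real.sin (2 * y * k)| / y)
        ≤ y ^ 2 / 2 * (1 / y) := by
          gcongr
          · exact (abs_phaseInvDeriv_sub_half_le hy0).2
          · exact Real.abs_sin_le_one _
      _ = y / 2 := by field_simp
      _ ≤ phase β / 2 := by linarith [hy.2]
  have hi2 : IntegrableOn (fun y => (phaseInvDeriv y - 1 / 2) * (Real.sin (2 * y * k) / y))
      (Ioo (phase α) (phase β)) := by
    refine Measure.integrableOn_of_bounded (M := phase β / 2) (by simp) ?_
      ((ae_restrict_iff' measurableSet_Ioo).2 (ae_of_all _ hbd))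
    unfold phaseInvDeriv
    exact Measurable.aestronglyMeasurable (by fun_prop)
  rw [h1, integral_add (hi1.const_mul _) hi2, integral_const_mul]
  have h2 := norm_setIntegral_le_of_norm_le_const (μ := volume) (by simp) hbd
  rw [Real.norm_eq_abs, Real.volume_real_Ioo_of_le hAB] at h2
  have h3 := abs_integral_sin_div_le hk (hnn α) hAB
  rw [intervalIntegral.integral_of_le hAB, integral_Ioc_eq_integral_Ioo] at h3
  refine (abs_add_le _ _).trans ?_
  rw [abs_mul, abs_of_pos (by norm_num : (0 : ℝ) < 1 / 2)]
  have h4 : phase β / 2 * (phase β - phase α) ≤ phase b ^ 2 := by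
    nlinarith [hnn α, hnn β, hnn b]
  linarith

/-- Jordan's criterion. -/
theorem negligible_of_monotone {δ : ℝ} (hδ : 0 < δ) (hδ' : δ < 1 / 2) {m : ℝ → ℝ}
    (hm : Monotone m) (hlim : Tendsto m (𝓝[>] 0) (𝓝 0)) : Negligible (Ioo 0 δ) m := by
  have hp := measurable_phase
  have hsub : Ioo 0 δ ⊆ Ioo (0 : ℝ) (1 / 2) := Ioo_subset_Ioo_right hδ'.le
  have hm0 : ∀ v ∈ Ioo 0 δ, 0 ≤ m v := by
    intro v hv
    refine le_of_tendsto hlim ?_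
    filter_upwards [nhdsWithin_le_nhds (Iio_mem_nhds hv.1)] with w hw
    exact hm (le_of_lt hw)
  set M := max (m δ) 0 with hM
  have hM0 : 0 ≤ M := le_max_right _ _
  have hmM : ∀ v ∈ Ioo 0 δ, m v ≤ M := fun v hv => (hm hv.2.le).trans (le_max_left _ _)
  have hint : IntegrableOn m (Ioo 0 δ) := by
    refine Measure.integrableOn_of_bounded (M := M) (by simp) hm.measurable.aestronglyMeasurable
      ((ae_restrict_iff' measurableSet_Ioo).2 (ae_of_all _ fun v hv => ?_))
    rw [Real.norm_eq_abs, abs_of_nonneg (hm0 v hv)]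
    exact hmM v hv
  -- Layer-cake: `m` is the integral over `s` of the indicators of its superlevel sets, so its sine
  -- transform is the integral of theirs.
  set A : ℝ → Set ℝ := fun s => Ioo 0 δ ∩ {v | s < m v} with hA
  have hAm : ∀ s, MeasurableSet (A s) := fun s =>
    measurableSet_Ioo.inter (measurableSet_lt measurable_const hm.measurable)
  have hlayer : ∀ k, sineTransform (Ioo 0 δ) m k =
      ∫ s in Ioo 0 M, sineTransform (A s) (fun _ => 1) k := by
    intro k
    set F : ℝ → ℝ → ℝ := fun v s => {p : ℝ × ℝ | p.2 < m p.1}.indicator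
      (fun p => Real.sin (2 * phase p.1 * k) / phase p.1) (v, s) with hF
    have hset : MeasurableSet {p : ℝ × ℝ | p.2 < m p.1} :=
      measurableSet_lt measurable_snd (hm.measurable.comp measurable_fst)
    have hFi : Integrable (Function.uncurry F)
        ((volume.restrict (Ioo 0 δ)).prod (volume.restrict (Ioo 0 M))) := by
      refine Integrable.of_bound (C := 2 * |k|) ?_ (ae_of_all _ fun p => ?_)
      · refine Measurable.aestronglyMeasurable ?_
        exact Measurable.indicator (by fun_prop) hset
      · refine (norm_indicator_le_norm_self
          (fun p : ℝ × ℝ => Real.sin (2 * phase p.1 * k) / phase p.1) p).trans ?_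
        exact abs_sin_div_phase_le _ _
    have h1 : sineTransform (Ioo 0 δ) m k =
        ∫ v in Ioo 0 δ, ∫ s in Ioo 0 M, F v s := by
      refine setIntegral_congr_fun measurableSet_Ioo fun v hv => ?_
      have hFv : ∀ s, F v s = (Iio (m v)).indicator
          (fun _ => Real.sin (2 * phase v * k) / phase v) s := fun s => rfl
      simp only [hFv]
      rw [setIntegral_indicator measurableSet_Iio, Ioo_inter_Iio, min_eq_right (hmM v hv),
        setIntegral_const, Real.volume_real_Ioo_of_le (hm0 v hv), sub_zero, smul_eq_mul]
    rw [h1, integral_integral_swap hFi]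
    refine integral_congr_ae (ae_of_all _ fun s => ?_)
    have hFs : ∀ v, F v s = {v | s < m v}.indicator
          (fun v => Real.sin (2 * phase v * k) / phase v) v := fun v => rfl
    simp only [hFs, sineTransform, one_mul]
    rw [setIntegral_indicator (measurableSet_lt measurable_const hm.measurable)]
  have hbd : ∀ k ∈ Ioi (0 : ℝ), ∀ s,
      |sineTransform (A s) (fun _ => 1) k| ≤ 2 + phase δ ^ 2 := by
    intro k hk s
    -- By monotonicity the superlevel set is, up to an endpoint, the interval from `α` to `δ`.
    -- Inserting `δ` covers the case where it is empty.
    set α := sInf (insert δ (A s)) with hα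
    have hbdd : BddBelow (insert δ (A s)) := by
      refine ⟨0, ?_⟩
      rintro v (rfl | hv)
      · exact hδ.le
      · exact hv.1.1.le
    have hα0 : 0 ≤ α := by
      refine le_csInf (insert_nonempty _ _) ?_
      rintro v (rfl | hv)
      · exact hδ.le
      · exact hv.1.1.le
    have hαδ : α ≤ δ := csInf_le hbdd (mem_insert _ _)
    have h1 : Ioo α δ ⊆ A s := by
      intro v hv
      obtain ⟨a, ha, hav⟩ := exists_lt_of_csInf_lt (insert_nonempty _ _) hv.1
      rcases ha with rfl | ha
      · exact absurd hv.2 (not_lt.2 hav.le)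
      · exact ⟨⟨ha.1.1.trans hav, hv.2⟩, lt_of_lt_of_le ha.2 (hm hav.le)⟩
    have h2 : A s ⊆ Ico α δ := fun v hv =>
      ⟨csInf_le hbdd (mem_insert_of_mem _ hv), hv.1.2⟩
    have hae : (A s : Set ℝ) =ᵐ[volume] Ioo α δ :=
      ((LE.le.eventuallyLE h2).trans Ioo_ae_eq_Ico.symm.le).antisymm
        (LE.le.eventuallyLE h1)
    have h3 : sineTransform (A s) (fun _ => 1) k = sineTransform (Ioo α δ) (fun _ => 1) k :=
      setIntegral_congr_set hae
    rw [h3]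
    exact abs_sineTransform_Ioo_le hk hα0 hαδ le_rfl hδ'
  refine ⟨hint, ⟨(2 + phase δ ^ 2) * M, fun k hk => ?_⟩, ?_⟩
  · rw [hlayer, ← Real.norm_eq_abs]
    have := norm_setIntegral_le_of_norm_le_const (μ := volume) (s := Ioo 0 M)
      (f := fun s => sineTransform (A s) (fun _ => 1) k) (by simp) (fun s _ => hbd k hk s)
    rwa [Real.volume_real_Ioo_of_le hM0, sub_zero] at this
  · have key : Tendsto (fun k => ∫ s in Ioo 0 M, sineTransform (A s) (fun _ => 1) k) atTop
        (𝓝 (∫ s in Ioo 0 M, (0 : ℝ))) := by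
      refine tendsto_integral_filter_of_dominated_convergence (fun _ => 2 + phase δ ^ 2) ?_ ?_
        (by simp) ?_
      · refine Eventually.of_forall fun k => ?_
        have hset : MeasurableSet {p : ℝ × ℝ | p.2 ∈ Ioo 0 δ ∧ p.1 < m p.2} :=
          (measurable_snd measurableSet_Ioo).inter
            (measurableSet_lt measurable_fst (hm.measurable.comp measurable_snd))
        have hmeas : StronglyMeasurable (Function.uncurry fun s v : ℝ =>
            {p : ℝ × ℝ | p.2 ∈ Ioo 0 δ ∧ p.1 < m p.2}.indicator
              (fun p => Real.sin (2 * phase p.2 * k) / phase p.2) (s, v)) :=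
          (Measurable.indicator (by fun_prop) hset).stronglyMeasurable
        have := (hmeas.integral_prod_right (ν := volume)).aestronglyMeasurable
          (μ := volume.restrict (Ioo 0 M))
        refine this.congr (ae_of_all _ fun s => ?_)
        simp only [sineTransform, one_mul]
        rw [← integral_indicator (hAm s)]
        rfl
      · filter_upwards [eventually_gt_atTop 0] with k hk
        exact ae_of_all _ fun s => hbd k hk s
      · refine (ae_restrict_iff' measurableSet_Ioo).2 (ae_of_all _ fun s hs => ?_)
        refine Negligible.tendsto (negligible_of_integrableOn_div (hAm s)
          (inter_subset_left.trans hsub) ?_)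
        -- For `s > 0` the superlevel set stays away from `0`, because `m` tends to `0` there; so
        -- its indicator satisfies Dini's condition.
        obtain ⟨η, hη, hηs⟩ := mem_nhdsGT_iff_exists_Ioo_subset.1
          (hlim.eventually (Iio_mem_nhds hs.1))
        have hη0 : 0 < η := hη
        refine Measure.integrableOn_of_bounded (M := η⁻¹) ?_ (by fun_prop) ?_
        · exact ((measure_mono inter_subset_left).trans_lt (by simp)).ne
        · refine (ae_restrict_iff' (hAm s)).2 (ae_of_all _ fun v hv => ?_)
          have hηv : η ≤ v := by
            by_contra! h
            have h1 : m v < s := hηs ⟨hv.1.1, h⟩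
            exact absurd h1 (not_lt.2 (le_of_lt hv.2))
          rw [one_mul, norm_inv, Real.norm_eq_abs, abs_of_pos hv.1.1]
          exact inv_anti₀ hη0 hηv
    rw [integral_zero] at key
    exact key.congr fun k => (hlayer k).symm

/-- Jordan's criterion for a function that is monotone near `0`. -/
theorem negligible_of_monotoneOn {δ : ℝ} (hδ : 0 < δ) (hδ' : δ < 1 / 2) {m : ℝ → ℝ}
    (hm : MonotoneOn m (Ioc 0 δ)) (hlim : Tendsto m (𝓝[>] 0) (𝓝 0)) :
    Negligible (Ioo 0 δ) m := by
  have hm0 : ∀ v ∈ Ioc 0 δ, 0 ≤ m v := by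
    intro v hv
    refine le_of_tendsto hlim ?_
    filter_upwards [Ioo_mem_nhdsGT hv.1] with w hw
    exact hm ⟨hw.1, hw.2.le.trans hv.2⟩ hv hw.2.le
  -- A globally monotone extension: `0` on the left, constant `m δ` on the right.
  set m' : ℝ → ℝ := fun v => if v ≤ 0 then 0 else m (min v δ) with hm'
  have heq : EqOn m' m (Ioo 0 δ) := by
    intro v hv
    simp only [hm', not_le.2 hv.1, if_false, min_eq_left hv.2.le]
  have hmono : Monotone m' := by
    intro a b hab
    simp only [hm']
    have hmem : ∀ v : ℝ, ¬ v ≤ 0 → min v δ ∈ Ioc 0 δ := fun v hv =>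
      ⟨lt_min (not_le.1 hv) hδ, min_le_right _ _⟩
    split_ifs with h1 h2 h2
    · exact le_rfl
    · exact hm0 _ (hmem b h2)
    · exact absurd (hab.trans h2) h1
    · exact hm (hmem a h1) (hmem b h2) (min_le_min_right _ hab)
  refine (negligible_of_monotone hδ hδ' hmono (hlim.congr' ?_)).congr measurableSet_Ioo heq
  filter_upwards [Ioo_mem_nhdsGT hδ] with v hv
  exact (heq hv).symm

/-! ### The approximation as an integral against the kernel -/

/-- The binomial expansion of `(-Y)^j (1 - Y)^j`, supported on `j ≤ k ≤ 2j`. The condition `j ≤ k`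
is essential: truncated subtraction would otherwise produce `C(j,0) = 1`. -/
theorem sum_neg_one_pow_mul_choose_mul_pow {n j : ℕ} (hj : j ∈ Finset.Icc 1 n) (Y : ℝ) :
    ∑ k ∈ Finset.Icc 1 (2 * n), (-1 : ℝ) ^ k * (if j ≤ k then (j.choose (k - j) : ℝ) else 0) * Y ^ k =
      (-1) ^ j * (Y * (1 - Y)) ^ j := by
  rw [Finset.mem_Icc] at hj
  have h1 : ∑ k ∈ Finset.Icc 1 (2 * n),
      (-1 : ℝ) ^ k * (if j ≤ k then (j.choose (k - j) : ℝ) else 0) * Y ^ k =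
      ∑ k ∈ Finset.Ico j (j + (j + 1)),
      (-1 : ℝ) ^ k * (if j ≤ k then (j.choose (k - j) : ℝ) else 0) * Y ^ k := by
    symm
    apply Finset.sum_subset
    · intro k hk
      simp only [Finset.mem_Ico, Finset.mem_Icc] at hk ⊢
      omega
    · intro k hk hk'
      simp only [Finset.mem_Ico, Finset.mem_Icc] at hk hk'
      split_ifs with h
      · rw [Nat.choose_eq_zero_of_lt (by omega)]; simp
      · simp
  rw [h1, Finset.sum_Ico_eq_sum_range, Nat.add_sub_cancel_left, mul_pow, ← mul_assoc, ← mul_pow,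
    sub_eq_neg_add, add_pow, Finset.mul_sum]
  refine Finset.sum_congr rfl fun i _ => ?_
  simp only [le_add_iff_nonneg_right, zero_le, if_true, Nat.add_sub_cancel_left, one_pow, mul_one]
  rw [neg_pow Y, pow_add, pow_add, mul_pow]
  ring

/-- Makes the range of `j` independent of `k`, so that the sums can be exchanged; the added terms
vanish. -/
theorem coeff_eq (n : ℕ) {k : ℕ} (hk : 1 ≤ k) :
    coeff n k = ∑ j ∈ Finset.Icc 1 n, (-1 : ℝ) ^ n / n.factorial *
      ((j : ℝ) ^ (n + 1) * (n.choose j : ℝ) * (j.centralBinom : ℝ)) *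
        ((-1 : ℝ) ^ k * (if j ≤ k then (j.choose (k - j) : ℝ) else 0)) := by
  unfold coeff
  rw [Finset.mul_sum]
  have h : ∀ j ∈ Finset.Icc ((k + 1) / 2) (min k n),
      (-1 : ℝ) ^ (n + k) / (n.factorial : ℝ) * ((j : ℝ) ^ (n + 1) * (n.choose j : ℝ) *
        ((2 * j).choose j : ℝ) * (j.choose (k - j) : ℝ)) = (-1 : ℝ) ^ n / n.factorial *
      ((j : ℝ) ^ (n + 1) * (n.choose j : ℝ) * (j.centralBinom : ℝ)) *
        ((-1 : ℝ) ^ k * (if j ≤ k then (j.choose (k - j) : ℝ) else 0)) := by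
    intro j hj
    simp only [Finset.mem_Icc, le_min_iff] at hj
    rw [if_pos hj.2.1, pow_add, Nat.centralBinom]
    ring
  rw [Finset.sum_congr rfl h]
  apply Finset.sum_subset
  · intro j hj
    simp only [Finset.mem_Icc, le_min_iff] at hj ⊢
    omega
  · intro j hj hj'
    simp only [Finset.mem_Icc, le_min_iff] at hj hj'
    split_ifs with h
    · rw [Nat.choose_eq_zero_of_lt (by omega : j < k - j)]; simp
    · simp

/-- With `Y = 1/2 + v` one has `Y(1 - Y) = 1/4 - v^2`: this is where the symmetry `v ↦ -v` appears.
-/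
theorem sum_coeff_mul_pow (n : ℕ) (v : ℝ) :
    ∑ k ∈ Finset.Icc 1 (2 * n), coeff n k * (1 / 2 + v) ^ k = (1 / 4 - v ^ 2) * kern n v := by
  have h : ∀ k ∈ Finset.Icc 1 (2 * n), coeff n k * (1 / 2 + v) ^ k =
      ∑ j ∈ Finset.Icc 1 n, (-1 : ℝ) ^ n / n.factorial *
      ((j : ℝ) ^ (n + 1) * (n.choose j : ℝ) * (j.centralBinom : ℝ)) *
        ((-1 : ℝ) ^ k * (if j ≤ k then (j.choose (k - j) : ℝ) else 0) * (1 / 2 + v) ^ k) := by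
    intro k hk
    rw [coeff_eq n (Finset.mem_Icc.1 hk).1, Finset.sum_mul]
    exact Finset.sum_congr rfl fun j _ => by ring
  rw [Finset.sum_congr rfl h, Finset.sum_comm, kern, Finset.mul_sum]
  refine Finset.sum_congr rfl fun j hj => ?_
  rw [← Finset.mul_sum, sum_neg_one_pow_mul_choose_mul_pow hj, weight]
  have e : (1 / 2 + v) * (1 - (1 / 2 + v)) = 1 / 4 - v ^ 2 := by ring
  rw [e]
  obtain ⟨m, rfl⟩ : ∃ m, j = m + 1 := ⟨j - 1, by simp at hj; omega⟩
  rw [Nat.add_sub_cancel]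
  ring

/-- The function `f` in the variable `v` with `1/2 + v = 2^(-t/x)`. -/
noncomputable def pull (f : ℝ → ℝ) (x v : ℝ) : ℝ := f (-x * Real.logb 2 (1 / 2 + v))

theorem image_neg_mul_logb {x : ℝ} (hx : 0 < x) :
    (fun v => -x * Real.logb 2 (1 / 2 + v)) '' Ioo (-(1 / 2)) (1 / 2) = Ioi 0 := by
  ext t
  constructor
  · rintro ⟨v, hv, rfl⟩
    have := Real.logb_neg (b := 2) (by norm_num) (by linarith [hv.1] : 0 < 1 / 2 + v)
      (by linarith [hv.2])
    have h2 : 0 < x * -Real.logb 2 (1 / 2 + v) := mul_pos hx (by linarith)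
    simp only [mem_Ioi]
    linarith
  · intro ht
    have ht : 0 < t := ht
    have h0 : (0 : ℝ) < 2 ^ (-t / x) := by positivity
    have h1 : (2 : ℝ) ^ (-t / x) < 1 :=
      Real.rpow_lt_one_of_one_lt_of_neg (by norm_num) (div_neg_of_neg_of_pos (by linarith) hx)
    refine ⟨2 ^ (-t / x) - 1 / 2, ⟨by linarith, by linarith⟩, ?_⟩
    simp only
    rw [add_sub_cancel, Real.logb_rpow (by norm_num) (by norm_num)]
    field_simp

theorem hasDerivWithinAt_neg_mul_logb (x : ℝ) :
    ∀ v ∈ Ioo (-(1 / 2) : ℝ) (1 / 2), HasDerivWithinAt (fun v => -x * Real.logb 2 (1 / 2 + v))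
      (-x * (1 / (1 / 2 + v) / Real.log 2)) (Ioo (-(1 / 2)) (1 / 2)) v := by
  intro v hv
  have h1 : HasDerivAt (fun v : ℝ => 1 / 2 + v) 1 v := (hasDerivAt_id v).const_add _
  have h2 := ((h1.log (by linarith [hv.1])).div_const (Real.log 2)).const_mul (-x)
  exact h2.hasDerivWithinAt

theorem injOn_neg_mul_logb {x : ℝ} (hx : 0 < x) :
    InjOn (fun v => -x * Real.logb 2 (1 / 2 + v)) (Ioo (-(1 / 2)) (1 / 2)) := by
  intro a ha b hb hab
  have h1 : Real.logb 2 (1 / 2 + a) = Real.logb 2 (1 / 2 + b) :=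
    mul_left_cancel₀ (neg_ne_zero.2 hx.ne') hab
  have := Real.logb_injOn_pos (b := 2) (by norm_num) (mem_Ioi.2 (by linarith [ha.1]))
    (mem_Ioi.2 (by linarith [hb.1])) h1
  linarith

theorem abs_deriv_smul_exp_mul {x : ℝ} (hx : 0 < x) (f : ℝ → ℝ) (m : ℕ) {v : ℝ}
    (hv : v ∈ Ioo (-(1 / 2) : ℝ) (1 / 2)) :
    |-x * (1 / (1 / 2 + v) / Real.log 2)| •
      (Real.exp (-(((m + 1 : ℕ) : ℝ) * (Real.log 2 / x)) * (-x * Real.logb 2 (1 / 2 + v))) *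
        f (-x * Real.logb 2 (1 / 2 + v))) =
      x / Real.log 2 * ((1 / 2 + v) ^ m * pull f x v) := by
  have hY : 0 < 1 / 2 + v := by linarith [hv.1]
  have hl : 0 < Real.log 2 := Real.log_pos (by norm_num)
  have h1 : -(((m + 1 : ℕ) : ℝ) * (Real.log 2 / x)) * (-x * Real.logb 2 (1 / 2 + v)) =
      ((m + 1 : ℕ) : ℝ) * Real.log (1 / 2 + v) := by
    rw [Real.logb]
    field_simp
  rw [h1, Real.exp_nat_mul, Real.exp_log hY, neg_mul, abs_neg, abs_of_pos (by positivity),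
    smul_eq_mul, pull]
  generalize 1 / 2 + v = Y at hY
  rw [pow_succ]
  field_simp

theorem integrableOn_pow_mul_pull {f : ℝ → ℝ} (hf : Admissible f) {x : ℝ} (hx : 0 < x) (m : ℕ) :
    IntegrableOn (fun v => (1 / 2 + v) ^ m * pull f x v) (Ioo (-(1 / 2)) (1 / 2)) := by
  have hl : 0 < Real.log 2 := Real.log_pos (by norm_num)
  have h := hf.laplace_exists (((m + 1 : ℕ) : ℝ) * (Real.log 2 / x)) (by positivity)
  rw [← image_neg_mul_logb hx, integrableOn_image_iff_integrableOn_abs_deriv_smul measurableSet_Ioo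
    (hasDerivWithinAt_neg_mul_logb x) (injOn_neg_mul_logb hx)] at h
  have h2 : IntegrableOn (fun v => x / Real.log 2 * ((1 / 2 + v) ^ m * pull f x v))
      (Ioo (-(1 / 2)) (1 / 2)) :=
    h.congr_fun (fun v hv => abs_deriv_smul_exp_mul hx f m hv) measurableSet_Ioo
  have h3 := h2.const_mul (Real.log 2 / x)
  refine h3.congr (ae_of_all _ fun v => ?_)
  field_simp

theorem laplace_eq (f : ℝ → ℝ) {x : ℝ} (hx : 0 < x) (m : ℕ) :
    laplace f (((m + 1 : ℕ) : ℝ) * (Real.log 2 / x)) =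
      x / Real.log 2 * ∫ v in Ioo (-(1 / 2)) (1 / 2), (1 / 2 + v) ^ m * pull f x v := by
  unfold laplace
  rw [← image_neg_mul_logb hx, integral_image_eq_integral_abs_deriv_smul measurableSet_Ioo
    (hasDerivWithinAt_neg_mul_logb x) (injOn_neg_mul_logb hx), ← integral_const_mul]
  exact setIntegral_congr_fun measurableSet_Ioo fun v hv => abs_deriv_smul_exp_mul hx f m hv

theorem integrableOn_pull {f : ℝ → ℝ} (hf : Admissible f) {x : ℝ} (hx : 0 < x) :
    IntegrableOn (pull f x) (Ioo (-(1 / 2)) (1 / 2)) := by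
  simpa using integrableOn_pow_mul_pull hf hx 0

theorem approx_eq_integral {f : ℝ → ℝ} (hf : Admissible f) {x : ℝ} (hx : 0 < x) (n : ℕ) :
    approx f n x =
      ∫ v in Ioo (-(1 / 2)) (1 / 2), pull f x v * (1 / 2 - v) * kern n v := by
  have hl : 0 < Real.log 2 := Real.log_pos (by norm_num)
  have h1 : approx f n x = ∑ k ∈ Finset.Icc 1 (2 * n), ∫ v in Ioo (-(1 / 2)) (1 / 2),
      coeff n k * ((1 / 2 + v) ^ (k - 1) * pull f x v) := by
    unfold approx
    rw [Finset.mul_sum]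
    refine Finset.sum_congr rfl fun k hk => ?_
    obtain ⟨m, rfl⟩ : ∃ m, k = m + 1 := ⟨k - 1, by simp at hk; omega⟩
    rw [laplace_eq f hx, Nat.add_sub_cancel, integral_const_mul]
    field_simp
  rw [h1, ← integral_finsetSum _ fun k _ => (integrableOn_pow_mul_pull hf hx _).const_mul _]
  refine setIntegral_congr_fun measurableSet_Ioo fun v hv => ?_
  have hY : 1 / 2 + v ≠ 0 := by linarith [hv.1]
  refine mul_left_cancel₀ hY ?_
  rw [Finset.mul_sum]
  have h2 : ∀ k ∈ Finset.Icc 1 (2 * n), (1 / 2 + v) * (coeff n k * ((1 / 2 + v) ^ (k - 1) *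
      pull f x v)) = pull f x v * (coeff n k * (1 / 2 + v) ^ k) := by
    intro k hk
    obtain ⟨m, rfl⟩ : ∃ m, k = m + 1 := ⟨k - 1, by simp at hk; omega⟩
    rw [Nat.add_sub_cancel, pow_succ]
    ring
  rw [Finset.sum_congr rfl h2, ← Finset.mul_sum, sum_coeff_mul_pow]
  ring

theorem integral_Ioo_neg_eq {F : ℝ → ℝ} {a : ℝ} (ha : 0 ≤ a) (hF : IntegrableOn F (Ioo (-a) a)) :
    IntegrableOn (fun v => F (-v)) (Ioo 0 a) ∧
    ∫ v in Ioo (-a) a, F v = ∫ v in Ioo 0 a, (F v + F (-v)) := by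
  have hI : IntervalIntegrable F volume (-a) a := by
    rw [intervalIntegrable_iff_integrableOn_Ioo_of_le (by linarith)]
    exact hF
  have h1 : IntervalIntegrable F volume (-a) 0 := hI.mono_set (by
    rw [uIcc_of_le (by linarith), uIcc_of_le (by linarith)]
    exact Icc_subset_Icc_right ha)
  have h2 : IntervalIntegrable F volume 0 a := hI.mono_set (by
    rw [uIcc_of_le (by linarith), uIcc_of_le (by linarith)]
    exact Icc_subset_Icc_left (by linarith))
  have h3 : IntervalIntegrable (fun v => F (-v)) volume 0 a := by
    simpa using ((IntervalIntegrable.iff_comp_neg (by finiteness)).1 h1).symm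
  refine ⟨(intervalIntegrable_iff_integrableOn_Ioo_of_le ha).1 h3, ?_⟩
  rw [← integral_Ioc_eq_integral_Ioo, ← integral_Ioc_eq_integral_Ioo,
    ← intervalIntegral.integral_of_le (by linarith), ← intervalIntegral.integral_of_le ha,
    ← intervalIntegral.integral_add_adjacent_intervals h1 h2,
    intervalIntegral.integral_add h2 h3, intervalIntegral.integral_comp_neg, neg_zero, add_comm]

/-- The function against which the kernel `kern n` is integrated over `(0, 1/2)`. -/
noncomputable def fold (f : ℝ → ℝ) (x v : ℝ) : ℝ :=
  pull f x v * (1 / 2 - v) + pull f x (-v) * (1 / 2 + v)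

theorem integrableOn_pull_half {f : ℝ → ℝ} (hf : Admissible f) {x : ℝ} (hx : 0 < x) :
    IntegrableOn (pull f x) (Ioo 0 (1 / 2)) ∧
      IntegrableOn (fun v => pull f x (-v)) (Ioo 0 (1 / 2)) :=
  ⟨(integrableOn_pull hf hx).mono_set (Ioo_subset_Ioo_left (by norm_num)),
    (integral_Ioo_neg_eq (by norm_num) (integrableOn_pull hf hx)).1⟩

theorem mul_continuousOn_Ioo {φ g : ℝ → ℝ} {a b : ℝ} (hφ : IntegrableOn φ (Ioo a b))
    (hg : ContinuousOn g (Icc a b)) : IntegrableOn (fun v => φ v * g v) (Ioo a b) :=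
  IntegrableOn.mul_continuousOn_of_subset hφ hg measurableSet_Ioo isCompact_Icc Ioo_subset_Icc_self

theorem integrableOn_fold {f : ℝ → ℝ} (hf : Admissible f) {x : ℝ} (hx : 0 < x) :
    IntegrableOn (fold f x) (Ioo 0 (1 / 2)) :=
  (mul_continuousOn_Ioo (integrableOn_pull_half hf hx).1 (by fun_prop)).add
    (mul_continuousOn_Ioo (integrableOn_pull_half hf hx).2 (by fun_prop))

theorem approx_eq_integral_fold {f : ℝ → ℝ} (hf : Admissible f) {x : ℝ} (hx : 0 < x) (n : ℕ) :
    approx f n x = ∫ v in Ioo 0 (1 / 2), fold f x v * kern n v := by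
  have hc := continuous_kern n
  have hF : IntegrableOn (fun v => pull f x v * (1 / 2 - v) * kern n v)
      (Ioo (-(1 / 2)) (1 / 2)) :=
    mul_continuousOn_Ioo (mul_continuousOn_Ioo (integrableOn_pull hf hx) (by fun_prop))
      hc.continuousOn
  rw [approx_eq_integral hf hx, (integral_Ioo_neg_eq (by norm_num) hF).2]
  refine integral_congr_ae (ae_of_all _ fun v => ?_)
  simp only [kern_neg, fold]
  ring

/-! ### Linearity and exactness on constants -/

theorem laplace_sub {f g : ℝ → ℝ} (hf : Admissible f) (hg : Admissible g) {z : ℝ} (hz : 0 < z) :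
    laplace (f - g) z = laplace f z - laplace g z := by
  unfold laplace
  rw [← integral_sub (hf.laplace_exists z hz) (hg.laplace_exists z hz)]
  simp only [Pi.sub_apply, mul_sub]

theorem approx_sub {f g : ℝ → ℝ} (hf : Admissible f) (hg : Admissible g) {x : ℝ} (hx : 0 < x)
    (n : ℕ) : approx (f - g) n x = approx f n x - approx g n x := by
  have hl : 0 < Real.log 2 := Real.log_pos (by norm_num)
  unfold approx
  rw [← mul_sub, ← Finset.sum_sub_distrib]
  congr 1
  refine Finset.sum_congr rfl fun k hk => ?_
  have hk0 : 0 < (k : ℝ) := by simp at hk; simp; omega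
  rw [laplace_sub hf hg (by positivity), mul_sub]

theorem Admissible.sub {f g : ℝ → ℝ} (hf : Admissible f) (hg : Admissible g) :
    Admissible (f - g) := by
  refine ⟨hf.1.sub hg.1, fun z hz => ?_⟩
  refine ((hf.2 z hz).sub (hg.2 z hz)).congr (ae_of_all _ fun t => ?_)
  simp only [Pi.sub_apply, mul_sub]

theorem admissible_const (c : ℝ) : Admissible fun _ => c := by
  refine ⟨(continuous_const.continuousOn).locallyIntegrableOn measurableSet_Ioi, fun z hz => ?_⟩
  exact (integrableOn_exp_mul_Ioi (by linarith) 0).mul_const c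

/-- Integrating the derivative of `v (1/4 - v^2)^(m+1)`, which vanishes at both endpoints, matches
the recursion of the central binomial coefficients. -/
theorem integral_sub_sq_pow (m : ℕ) :
    (2 * (m : ℝ) + 1) * (m.centralBinom : ℝ) *
      ∫ v in (0 : ℝ)..(1 / 2), (1 / 4 - v ^ 2) ^ m = 1 / 2 := by
  induction m with
  | zero => simp
  | succ m ih =>
    have hi : ∀ m : ℕ, IntervalIntegrable (fun v : ℝ => (1 / 4 - v ^ 2) ^ m) volume 0 (1 / 2) :=
      fun m => Continuous.intervalIntegrable (by fun_prop) _ _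
    have h : ∫ v in (0 : ℝ)..(1 / 2), ((2 * m + 3) * (1 / 4 - v ^ 2) ^ (m + 1) -
        (m + 1) / 2 * (1 / 4 - v ^ 2) ^ m) =
        (1 / 2) * (1 / 4 - (1 / 2) ^ 2) ^ (m + 1) - 0 * (1 / 4 - (0 : ℝ) ^ 2) ^ (m + 1) := by
      refine intervalIntegral.integral_eq_sub_of_hasDerivAt
        (f := fun v : ℝ => v * (1 / 4 - v ^ 2) ^ (m + 1)) (fun v _ => ?_)
        (((hi _).const_mul _).sub ((hi _).const_mul _))
      have h1 : HasDerivAt (fun v : ℝ => 1 / 4 - v ^ 2) (-(2 * v)) v := by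
        exact ((hasDerivAt_pow 2 v).const_sub (1 / 4)).congr_deriv (by norm_num)
      refine ((hasDerivAt_id v).mul (h1.pow (m + 1))).congr_deriv ?_
      simp only [id, Nat.add_sub_cancel, Pi.pow_apply]
      push_cast
      ring
    rw [intervalIntegral.integral_sub ((hi _).const_mul _) ((hi _).const_mul _),
      intervalIntegral.integral_const_mul, intervalIntegral.integral_const_mul] at h
    have hb : ((m : ℝ) + 1) * ((m + 1).centralBinom : ℝ) =
        2 * (2 * m + 1) * (m.centralBinom : ℝ) := by
      exact_mod_cast Nat.succ_mul_centralBinom_succ m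
    have e : (1 / 4 : ℝ) - (1 / 2) ^ 2 = 0 := by norm_num
    rw [e, zero_pow m.succ_ne_zero, mul_zero, zero_mul, sub_zero] at h
    push_cast
    linear_combination ((m + 1).centralBinom : ℝ) * h +
      (1 / 2 * ∫ v in (0 : ℝ)..(1 / 2), (1 / 4 - v ^ 2) ^ m) * hb + ih

/-- The factor `j C(2j,j)` normalizes each power of `1/4 - v^2` to the same integral, so the claim
is that the weights sum to `1`. -/
theorem approx_const (c : ℝ) {x : ℝ} (hx : 0 < x) {n : ℕ} (hn : 1 ≤ n) :
    approx (fun _ => c) n x = c := by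
  rw [approx_eq_integral_fold (admissible_const c) hx]
  have h : ∀ v, fold (fun _ => c) x v * kern n v = ∑ j ∈ Finset.Icc 1 n,
      c * (weight n j * (j * j.centralBinom)) * (1 / 4 - v ^ 2) ^ (j - 1) := by
    intro v
    rw [kern, Finset.mul_sum]
    refine Finset.sum_congr rfl fun j _ => ?_
    simp only [fold, pull]
    ring
  simp_rw [h]
  rw [← integral_Ioc_eq_integral_Ioo, ← intervalIntegral.integral_of_le (by norm_num),
    intervalIntegral.integral_finsetSum
      fun j _ => Continuous.intervalIntegrable (by fun_prop) _ _]
  conv_rhs => rw [← mul_one c, ← sum_weight hn, Finset.mul_sum]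
  refine Finset.sum_congr rfl fun j hj => ?_
  obtain ⟨m, rfl⟩ : ∃ m, j = m + 1 := ⟨j - 1, by simp at hj; omega⟩
  rw [intervalIntegral.integral_const_mul, Nat.add_sub_cancel]
  have hb : ((m : ℝ) + 1) * ((m + 1).centralBinom : ℝ) =
      2 * (2 * m + 1) * (m.centralBinom : ℝ) := by
    exact_mod_cast Nat.succ_mul_centralBinom_succ m
  have := integral_sub_sq_pow m
  push_cast
  rw [hb]
  linear_combination (2 * c * weight n (m + 1)) * this

/-! ### The kernel near the endpoint, and localization -/

/-- One term of the exponential series gives `(4j)^(n+1)/(n+1)! ≤ exp(4j) ≤ 81^j`, as `e < 3`. The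
`4` is chosen so that `4^(n+1)` beats the binomial sum `2^n`. -/
theorem abs_weight_mul_le (n j : ℕ) :
    |weight n j| * j ≤ (n + 1) * (n.choose j : ℝ) * 81 ^ j / 4 ^ (n + 1) := by
  have h1 := Real.pow_div_factorial_le_exp (4 * (j : ℝ)) (by positivity) (n + 1)
  have h2 : Real.exp (4 * (j : ℝ)) ≤ 81 ^ j := by
    rw [show 4 * (j : ℝ) = j * 4 by ring, Real.exp_nat_mul]
    refine pow_le_pow_left₀ (Real.exp_pos _).le ?_ _
    have h3 : Real.exp 4 = Real.exp 1 ^ 4 := by rw [← Real.exp_nat_mul]; norm_num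
    rw [h3, show (81 : ℝ) = 3 ^ 4 by norm_num]
    exact pow_le_pow_left₀ (Real.exp_pos _).le (Real.exp_one_lt_d9.le.trans (by norm_num)) _
  have h4 : |weight n j| = (j : ℝ) ^ n * (n.choose j : ℝ) / (n.factorial : ℝ) := by
    simp [weight, abs_div, abs_mul]
  have h5 := h1.trans h2
  have hf : 0 < (n.factorial : ℝ) := by positivity
  rw [Nat.factorial_succ, Nat.cast_mul, div_le_iff₀ (by positivity), mul_pow] at h5
  rw [h4, le_div_iff₀ (by positivity), div_mul_eq_mul_div, div_mul_eq_mul_div,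
    div_le_iff₀ hf]
  have h6 := mul_le_mul_of_nonneg_left h5 (by positivity : 0 ≤ (n.choose j : ℝ))
  push_cast at h6
  calc _ = (n.choose j : ℝ) * (4 ^ (n + 1) * (j : ℝ) ^ (n + 1)) := by ring
    _ ≤ _ := h6
    _ = _ := by ring

/-- The factor `81^j` and the bound `C(2j,j) ≤ 4^j` give `324^j`, compensated by `1/4 - v^2` once
`v` is close enough to `1/2`; `499/1000` suffices. -/
theorem abs_kern_le (n : ℕ) {v : ℝ} (hv : v ∈ Ico (499 / 1000 : ℝ) (1 / 2)) :
    |kern n v| ≤ 81 * ((n + 1) * (1 / 2) ^ n) := by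
  have hw : 0 ≤ 1 / 4 - v ^ 2 := by nlinarith [hv.1, hv.2]
  have hw' : 324 * (1 / 4 - v ^ 2) ≤ 1 := by nlinarith [hv.1, hv.2]
  have hterm : ∀ j ∈ Finset.Icc 1 n,
      |weight n j * (j * j.centralBinom * (1 / 4 - v ^ 2) ^ (j - 1))| ≤
        324 * (n + 1) / 4 ^ (n + 1) * (n.choose j : ℝ) := by
    intro j hj
    obtain ⟨m, rfl⟩ : ∃ m, j = m + 1 := ⟨j - 1, by simp at hj; omega⟩
    rw [Nat.add_sub_cancel]
    have h1 := abs_weight_mul_le n (m + 1)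
    have h2 : ((m + 1).centralBinom : ℝ) ≤ 4 ^ (m + 1) := by
      have := Nat.choose_le_two_pow (2 * (m + 1)) (m + 1)
      rw [pow_mul] at this
      exact_mod_cast this
    have h3 : (324 * (1 / 4 - v ^ 2)) ^ m ≤ 1 := pow_le_one₀ (by positivity) hw'
    rw [abs_mul, abs_of_nonneg (by positivity : 0 ≤ ((m + 1 : ℕ) : ℝ) *
      ((m + 1).centralBinom : ℝ) * (1 / 4 - v ^ 2) ^ m)]
    calc |weight n (m + 1)| * (((m + 1 : ℕ) : ℝ) * ((m + 1).centralBinom : ℝ) *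
          (1 / 4 - v ^ 2) ^ m)
        = |weight n (m + 1)| * ((m + 1 : ℕ) : ℝ) *
          (((m + 1).centralBinom : ℝ) * (1 / 4 - v ^ 2) ^ m) := by ring
      _ ≤ (n + 1) * (n.choose (m + 1) : ℝ) * 81 ^ (m + 1) / 4 ^ (n + 1) *
          (4 ^ (m + 1) * (1 / 4 - v ^ 2) ^ m) := by gcongr
      _ = 324 * (n + 1) / 4 ^ (n + 1) * (n.choose (m + 1) : ℝ) *
          (324 * (1 / 4 - v ^ 2)) ^ m := by
        rw [mul_pow, show (324 : ℝ) = 81 * 4 by norm_num, mul_pow (81 : ℝ) 4 m]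
        ring
      _ ≤ 324 * (n + 1) / 4 ^ (n + 1) * (n.choose (m + 1) : ℝ) * 1 := by gcongr
      _ = _ := mul_one _
  have hsum : ∑ j ∈ Finset.Icc 1 n, (n.choose j : ℝ) ≤ 2 ^ n := by
    have h : ∑ j ∈ Finset.range (n + 1), n.choose j = 2 ^ n := Nat.sum_range_choose n
    have h' : ∑ j ∈ Finset.Icc 1 n, n.choose j ≤ 2 ^ n := by
      rw [← h]
      refine Finset.sum_le_sum_of_subset fun j hj => ?_
      simp only [Finset.mem_Icc, Finset.mem_range] at hj ⊢
      omega
    exact_mod_cast h'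
  calc |kern n v| ≤ ∑ j ∈ Finset.Icc 1 n, 324 * (n + 1) / 4 ^ (n + 1) * (n.choose j : ℝ) :=
        (Finset.abs_sum_le_sum_abs _ _).trans (Finset.sum_le_sum hterm)
    _ ≤ 324 * (n + 1) / 4 ^ (n + 1) * 2 ^ n := by
        rw [← Finset.mul_sum]
        gcongr
    _ = 81 * ((n + 1) * (1 / 2) ^ n) := by
        rw [pow_succ, show (4 : ℝ) = 2 * 2 by norm_num, mul_pow, one_div, inv_pow]
        field_simp
        norm_num

/-- Only `(0, δ)` needs a hypothesis: in the middle range `1/v` and `1/(1/4 - v^2)` are bounded, so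
Dini's condition holds. Near `1/2` the quotient need not be integrable, and the decay of the kernel
is used instead. -/
theorem tendsto_integral_mul_kern {h : ℝ → ℝ} (hh : IntegrableOn h (Ioo 0 (1 / 2))) {δ : ℝ}
    (hδ : δ ∈ Ioc (0 : ℝ) (1 / 4)) (hN : Negligible (Ioo 0 δ) fun v => h v / (1 / 4 - v ^ 2)) :
    Tendsto (fun n => ∫ v in Ioo 0 (1 / 2), h v * kern n v) atTop (𝓝 0) := by
  obtain ⟨hδ0, hδ1⟩ := hδ
  have inner : ∀ s : Set ℝ, MeasurableSet s → s ⊆ Ioo 0 (1 / 2) →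
      Negligible s (fun v => h v / (1 / 4 - v ^ 2)) →
      Tendsto (fun n => ∫ v in s, h v * kern n v) atTop (𝓝 0) := by
    intro s hs hs' hN
    refine (hN.tendsto_integral hs hs').congr fun n => setIntegral_congr_fun hs fun v hv => ?_
    have : 1 / 4 - v ^ 2 ≠ 0 := by nlinarith [(hs' hv).1, (hs' hv).2]
    rw [← mul_assoc, div_mul_cancel₀ _ this]
  have hA := inner _ measurableSet_Ioo (Ioo_subset_Ioo_right (by linarith)) hN
  have hsub : Ico δ (499 / 1000) ⊆ Ioo (0 : ℝ) (1 / 2) := fun v hv =>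
    ⟨hδ0.trans_le hv.1, hv.2.trans (by norm_num)⟩
  have hB := inner (Ico δ (499 / 1000)) measurableSet_Ico hsub
    (negligible_of_integrableOn_div measurableSet_Ico hsub (by
      have hc : ContinuousOn (fun v : ℝ => (1 / 4 - v ^ 2)⁻¹ * v⁻¹) (Icc δ (499 / 1000)) := by
        refine ContinuousOn.mul (ContinuousOn.inv₀ (by fun_prop) fun v hv => ?_)
          (continuousOn_id.inv₀ fun v hv => ?_)
        · nlinarith [hv.1, hv.2]
        · exact (hδ0.trans_le hv.1).ne'
      refine (IntegrableOn.mul_continuousOn_of_subset (hh.mono_set hsub) hc measurableSet_Ico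
        isCompact_Icc Ico_subset_Icc_self).congr (ae_of_all _ fun v => ?_)
      simp only [div_eq_mul_inv, mul_assoc]))
  have hsub' : Ico (499 / 1000) (1 / 2) ⊆ Ioo (0 : ℝ) (1 / 2) := fun v hv =>
    ⟨lt_of_lt_of_le (by norm_num) hv.1, hv.2⟩
  have hC : Tendsto (fun n => ∫ v in Ico (499 / 1000) (1 / 2), h v * kern n v) atTop (𝓝 0) := by
    have hlim : Tendsto (fun n : ℕ => 81 * (((n : ℝ) + 1) * (1 / 2) ^ n) *
        ∫ v in Ico (499 / 1000) (1 / 2), |h v|) atTop (𝓝 0) := by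
      have h1 := tendsto_self_mul_const_pow_of_lt_one (r := (1 / 2 : ℝ)) (by norm_num) (by norm_num)
      have h2 := tendsto_pow_atTop_nhds_zero_of_lt_one (r := (1 / 2 : ℝ)) (by norm_num)
        (by norm_num)
      have h3 := ((h1.add h2).const_mul 81).mul_const (∫ v in Ico (499 / 1000) (1 / 2), |h v|)
      rw [add_zero, mul_zero, zero_mul] at h3
      exact h3.congr fun n => by ring
    refine squeeze_zero_norm (fun n => ?_) hlim
    rw [← integral_const_mul]
    refine norm_integral_le_of_norm_le ((hh.mono_set hsub').abs.const_mul _)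
      ((ae_restrict_iff' measurableSet_Ico).2 (ae_of_all _ fun v hv => ?_))
    rw [norm_mul, mul_comm]
    exact mul_le_mul_of_nonneg_right (abs_kern_le n hv) (abs_nonneg _)
  have hsplit : ∀ n, ∫ v in Ioo 0 (1 / 2), h v * kern n v =
      (∫ v in Ioo 0 δ, h v * kern n v) + ((∫ v in Ico δ (499 / 1000), h v * kern n v) +
        ∫ v in Ico (499 / 1000) (1 / 2), h v * kern n v) := by
    intro n
    have hi : IntegrableOn (fun v => h v * kern n v) (Ioo 0 (1 / 2)) :=
      mul_continuousOn_Ioo hh (continuous_kern n).continuousOn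
    rw [← setIntegral_union _ measurableSet_Ico (hi.mono_set hsub) (hi.mono_set hsub'),
      Ico_union_Ico_eq_Ico (by linarith) (by norm_num), ← setIntegral_union _ measurableSet_Ico
      (hi.mono_set (Ioo_subset_Ioo_right (by linarith))), Ioo_union_Ico_eq_Ioo hδ0 (by linarith)]
    · exact hi.mono_set fun v hv => ⟨hδ0.trans_le hv.1, hv.2⟩
    · exact disjoint_left.2 fun v hv hv' => hv.2.not_ge hv'.1
    · exact disjoint_left.2 fun v hv hv' => hv.2.not_ge hv'.1
  have := hA.add (hB.add hC)
  simp only [add_zero] at this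
  exact this.congr fun n => (hsplit n).symm

/-- Dividing `fold` by `1/4 - v^2` gives twice the symmetric sum of `pull` plus a remainder with a
factor `v`, which satisfies Dini's condition whatever the behaviour of `f` near `x`. -/
theorem tendsto_approx_zero {f : ℝ → ℝ} (hf : Admissible f) {x : ℝ} (hx : 0 < x) {δ : ℝ}
    (hδ : δ ∈ Ioc (0 : ℝ) (1 / 4))
    (hN : Negligible (Ioo 0 δ) fun v => pull f x v + pull f x (-v)) :
    Tendsto (fun n => approx f n x) atTop (𝓝 0) := by
  have hsub : Ioo 0 δ ⊆ Ioo (0 : ℝ) (1 / 2) := Ioo_subset_Ioo_right (by linarith [hδ.2])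
  obtain ⟨h1, h2⟩ := integrableOn_pull_half hf hx
  have hne : ∀ v ∈ Icc 0 δ, 1 / 4 - v ^ 2 ≠ 0 := fun v hv => by nlinarith [hv.1, hv.2, hδ.2]
  have hrem : Negligible (Ioo 0 δ) fun v => (2 * v ^ 2 * (pull f x v + pull f x (-v)) -
      v * (pull f x v - pull f x (-v))) / (1 / 4 - v ^ 2) := by
    refine negligible_of_integrableOn_div measurableSet_Ioo hsub ?_
    have h3 : IntegrableOn (fun v => (pull f x v) * ((2 * v - 1) / (1 / 4 - v ^ 2)) +
        pull f x (-v) * ((2 * v + 1) / (1 / 4 - v ^ 2))) (Ioo 0 δ) :=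
      (mul_continuousOn_Ioo (h1.mono_set hsub)
        (ContinuousOn.div (by fun_prop) (by fun_prop) hne)).add
      (mul_continuousOn_Ioo (h2.mono_set hsub)
        (ContinuousOn.div (by fun_prop) (by fun_prop) hne))
    refine h3.congr_fun (fun v hv => ?_) measurableSet_Ioo
    have hv0 := hv.1.ne'
    have := hne v ⟨hv.1.le, hv.2.le⟩
    simp only
    field_simp
    ring
  have hfold : Negligible (Ioo 0 δ) fun v => fold f x v / (1 / 4 - v ^ 2) := by
    refine ((hN.const_mul 2).add hrem).congr measurableSet_Ioo fun v hv => ?_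
    have := hne v ⟨hv.1.le, hv.2.le⟩
    simp only [fold]
    rw [eq_div_iff this, add_mul, div_mul_cancel₀ _ this]
    ring
  exact (tendsto_integral_mul_kern (integrableOn_fold hf hx) hδ hfold).congr fun n =>
    (approx_eq_integral_fold hf hx n).symm

theorem tendsto_approx {f : ℝ → ℝ} (hf : Admissible f) {x : ℝ} (hx : 0 < x) {δ c : ℝ}
    (hδ : δ ∈ Ioc (0 : ℝ) (1 / 4))
    (hN : Negligible (Ioo 0 δ) fun v => pull f x v + pull f x (-v) - 2 * c) :
    Tendsto (fun n => approx f n x) atTop (𝓝 c) := by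
  have h := tendsto_approx_zero (hf.sub (admissible_const c)) hx hδ
    (hN.congr measurableSet_Ioo fun v _ => by
      simp only [pull, Pi.sub_apply]
      ring)
  have h' := h.add_const c
  rw [zero_add] at h'
  refine h'.congr' (eventually_atTop.2 ⟨1, fun n hn => ?_⟩)
  rw [approx_sub hf (admissible_const c) hx, approx_const c hx hn, sub_add_cancel]

/-! ### Returning to `f` near `x`, and the three criteria -/

theorem exists_pull_mem {x : ℝ} {U : Set ℝ} (hU : U ∈ 𝓝 x) :
    ∃ δ ∈ Ioo (0 : ℝ) (1 / 4), ∀ v ∈ Ioo 0 δ,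
      -x * Real.logb 2 (1 / 2 + v) ∈ U ∧ -x * Real.logb 2 (1 / 2 + -v) ∈ U := by
  have h0 : -x * Real.logb 2 (1 / 2 + 0) = x := by
    rw [add_zero, one_div, Real.logb_inv, Real.logb_self_eq_one (by norm_num)]
    ring
  have hc : ContinuousAt (fun v => -x * Real.logb 2 (1 / 2 + v)) 0 :=
    ((hasDerivWithinAt_neg_mul_logb x 0 (by norm_num)).hasDerivAt
      (Ioo_mem_nhds (by norm_num) (by norm_num))).continuousAt
  have hU' : ∀ᶠ v in 𝓝 (0 : ℝ), -x * Real.logb 2 (1 / 2 + v) ∈ U :=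
    hc.eventually_mem (by simpa only [h0] using hU)
  obtain ⟨η, hη, h⟩ := Metric.eventually_nhds_iff.1 hU'
  refine ⟨min η (1 / 8), ⟨by positivity, (min_le_right _ _).trans_lt (by norm_num)⟩,
    fun v hv => ?_⟩
  have hv' : |v| < η := by
    rw [abs_of_pos hv.1]
    exact hv.2.trans_le (min_le_left _ _)
  exact ⟨h (by simpa using hv'), h (by simpa using hv')⟩

theorem monotoneOn_neg_mul_logb {x : ℝ} (hx : 0 < x) {δ : ℝ} (hδ : δ < 1 / 2) :
    MonotoneOn (fun v => -x * Real.logb 2 (1 / 2 + -v)) (Iic δ) := by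
  intro a ha b hb hab
  have ha : a ≤ δ := ha
  have hb : b ≤ δ := hb
  have := Real.logb_le_logb_of_le (b := 2) (by norm_num) (by linarith : 0 < 1 / 2 + -b)
    (by linarith : 1 / 2 + -b ≤ 1 / 2 + -a)
  simp only
  nlinarith

theorem antitoneOn_neg_mul_logb {x : ℝ} (hx : 0 < x) :
    AntitoneOn (fun v => -x * Real.logb 2 (1 / 2 + v)) (Ici 0) := by
  intro a ha b hb hab
  have ha : 0 ≤ a := ha
  have := Real.logb_le_logb_of_le (b := 2) (by norm_num) (by linarith : 0 < 1 / 2 + a)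
    (by linarith : 1 / 2 + a ≤ 1 / 2 + b)
  simp only
  nlinarith

theorem tendsto_neg_mul_logb {x : ℝ} (hx : 0 < x) :
    Tendsto (fun v => -x * Real.logb 2 (1 / 2 + v)) (𝓝[>] 0) (𝓝[<] x) ∧
      Tendsto (fun v => -x * Real.logb 2 (1 / 2 + -v)) (𝓝[>] 0) (𝓝[>] x) := by
  have hx0 : x = -x * Real.logb 2 (1 / 2) := by
    rw [one_div, Real.logb_inv, Real.logb_self_eq_one (by norm_num)]
    ring
  have hmem : ∀ U ∈ 𝓝 x, ∀ᶠ v in 𝓝[>] (0 : ℝ),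
      -x * Real.logb 2 (1 / 2 + v) ∈ U ∧ -x * Real.logb 2 (1 / 2 + -v) ∈ U := fun U hU => by
    obtain ⟨δ, hδ, h⟩ := exists_pull_mem hU
    filter_upwards [Ioo_mem_nhdsGT hδ.1] with v hv using h v hv
  constructor
  · refine tendsto_nhdsWithin_iff.2 ⟨fun U hU => (hmem U hU).mono fun v h => h.1, ?_⟩
    filter_upwards [self_mem_nhdsWithin] with v hv
    have hv : 0 < v := hv
    have := Real.logb_lt_logb (b := 2) (by norm_num) (by norm_num : (0 : ℝ) < 1 / 2)
      (by linarith : 1 / 2 < 1 / 2 + v)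
    simp only [mem_Iio]
    nlinarith
  · refine tendsto_nhdsWithin_iff.2 ⟨fun U hU => (hmem U hU).mono fun v h => h.2, ?_⟩
    filter_upwards [Ioo_mem_nhdsGT (by norm_num : (0 : ℝ) < 1 / 2)] with v hv
    have := Real.logb_lt_logb (b := 2) (by norm_num) (by linarith [hv.2] : 0 < 1 / 2 + -v)
      (by linarith [hv.1] : 1 / 2 + -v < 1 / 2)
    simp only [mem_Ioi]
    nlinarith

/-- Positive `v` corresponds to the left of `x` and negative `v` to the right. The two one-sided
deviations, suitably signed, increase from `0`, so Jordan's criterion applies to each. -/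
theorem negligible_pull_of_monotone {p : ℝ → ℝ} (hp : Monotone p) {x : ℝ} (hx : 0 < x) {δ : ℝ}
    (hδ : 0 < δ) (hδ' : δ < 1 / 2) : Negligible (Ioo 0 δ) fun v =>
      pull p x v + pull p x (-v) - (Function.leftLim p x + Function.rightLim p x) := by
  have hR : Negligible (Ioo 0 δ) fun v => pull p x (-v) - Function.rightLim p x := by
    refine negligible_of_monotoneOn hδ hδ' (fun a ha b hb hab => ?_) ?_
    · exact sub_le_sub_right (hp (monotoneOn_neg_mul_logb hx hδ' ha.2 hb.2 hab)) _
    · have := ((hp.tendsto_rightLim x).comp (tendsto_neg_mul_logb hx).2).sub_const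
        (Function.rightLim p x)
      rwa [sub_self] at this
  have hL : Negligible (Ioo 0 δ) fun v => Function.leftLim p x - pull p x v := by
    refine negligible_of_monotoneOn hδ hδ' (fun a ha b hb hab => ?_) ?_
    · exact sub_le_sub_left (hp (antitoneOn_neg_mul_logb hx ha.1.le hb.1.le hab)) _
    · have := ((hp.tendsto_leftLim x).comp (tendsto_neg_mul_logb hx).1).const_sub
        (Function.leftLim p x)
      rwa [sub_self] at this
  refine (hR.add (hL.const_mul (-1))).congr measurableSet_Ioo fun v _ => ?_
  simp only
  ring

/-- Jordan decomposition with both parts extended monotonically to the line, so that they have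
one-sided limits everywhere. -/
theorem exists_monotone_sub {f : ℝ → ℝ} {a b : ℝ} (hab : a ≤ b)
    (hf : BoundedVariationOn f (Icc a b)) :
    ∃ p q : ℝ → ℝ, Monotone p ∧ Monotone q ∧ EqOn f (p - q) (Icc a b) := by
  obtain ⟨p, q, hp, hq, hpq⟩ :=
    hf.locallyBoundedVariationOn.exists_monotoneOn_sub_monotoneOn
  have hext : ∀ g : ℝ → ℝ, MonotoneOn g (Icc a b) → ∃ g', Monotone g' ∧ EqOn g g' (Icc a b) := by
    intro g hg
    refine hg.exists_monotone_extension ⟨g a, ?_⟩ ⟨g b, ?_⟩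
    · rintro _ ⟨t, ht, rfl⟩
      exact hg (left_mem_Icc.2 hab) ht ht.1
    · rintro _ ⟨t, ht, rfl⟩
      exact hg ht (right_mem_Icc.2 hab) ht.2
  obtain ⟨p', hp', hpe⟩ := hext p hp
  obtain ⟨q', hq', hqe⟩ := hext q hq
  refine ⟨p', q', hp', hq', fun t ht => ?_⟩
  rw [hpq, Pi.sub_apply, Pi.sub_apply, hpe ht, hqe ht]

theorem tendsto_approx_of_boundedVariationOn {f : ℝ → ℝ} (hf : Admissible f) {x : ℝ} (hx : 0 < x)
    {U : Set ℝ} (hU : U ∈ 𝓝 x) (hbv : BoundedVariationOn f U) :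
    ∃ l r : ℝ, Tendsto f (𝓝[<] x) (𝓝 l) ∧ Tendsto f (𝓝[>] x) (𝓝 r) ∧
      Tendsto (fun n : ℕ => approx f n x) atTop (𝓝 ((r + l) / 2)) := by
  obtain ⟨η, hη, hηU⟩ := Metric.nhds_basis_closedBall.mem_iff.1 hU
  have hI := Metric.closedBall_mem_nhds x hη
  rw [Real.closedBall_eq_Icc] at hI hηU
  obtain ⟨p, q, hp, hq, hpq⟩ := exists_monotone_sub (by linarith) (hbv.mono hηU)
  have heq : p - q =ᶠ[𝓝 x] f := eventually_of_mem hI fun t ht => (hpq ht).symm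
  refine ⟨Function.leftLim p x - Function.leftLim q x,
    Function.rightLim p x - Function.rightLim q x,
    ((hp.tendsto_leftLim x).sub (hq.tendsto_leftLim x)).congr' (heq.filter_mono nhdsWithin_le_nhds),
    ((hp.tendsto_rightLim x).sub (hq.tendsto_rightLim x)).congr'
      (heq.filter_mono nhdsWithin_le_nhds), ?_⟩
  obtain ⟨δ, hδ, hδI⟩ := exists_pull_mem hI
  refine tendsto_approx hf hx ⟨hδ.1, hδ.2.le⟩ ?_
  refine ((negligible_pull_of_monotone hp hx hδ.1 (hδ.2.trans (by norm_num))).add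
    ((negligible_pull_of_monotone hq hx hδ.1 (hδ.2.trans (by norm_num))).const_mul (-1))).congr
    measurableSet_Ioo fun v hv => ?_
  simp only [pull, hpq (hδI v hv).1, hpq (hδI v hv).2, Pi.sub_apply]
  ring

theorem tendsto_approx_of_integrableOn {f : ℝ → ℝ} (hf : Admissible f) {x : ℝ} (hx : 0 < x)
    {c ε : ℝ} (hε : ε ∈ Ioo (0 : ℝ) (1 / 4))
    (h : IntegrableOn (fun v : ℝ => |f (-x * Real.logb 2 (1 / 2 + v)) +
      f (-x * Real.logb 2 (1 / 2 - v)) - 2 * c| * v⁻¹) (Ioo 0 ε)) :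
    Tendsto (fun n : ℕ => approx f n x) atTop (𝓝 c) := by
  have hsub : Ioo 0 ε ⊆ Ioo (0 : ℝ) (1 / 2) := Ioo_subset_Ioo_right (by linarith [hε.2])
  obtain ⟨h1, h2⟩ := integrableOn_pull_half hf hx
  refine tendsto_approx hf hx ⟨hε.1, hε.2.le⟩
    (negligible_of_integrableOn_div measurableSet_Ioo hsub ?_)
  refine Integrable.mono h ?_ (ae_of_all _ fun v => le_of_eq ?_)
  -- Integrability of the absolute value says nothing about measurability of the signed function;
  -- that comes from the integrability of `pull`.
  · refine AEStronglyMeasurable.mul (((h1.mono_set hsub).aestronglyMeasurable.add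
      (h2.mono_set hsub).aestronglyMeasurable).sub aestronglyMeasurable_const) ?_
    exact measurable_inv.aestronglyMeasurable
  · simp [pull, sub_eq_add_neg]

/-- The difference `f - g` vanishes near `x`, so its symmetric sum is zero near `v = 0` and
trivially negligible. -/
theorem tendsto_approx_sub_of_eventuallyEq {f g : ℝ → ℝ} (hf : Admissible f) (hg : Admissible g)
    {x : ℝ} (hx : 0 < x) (hfg : f =ᶠ[𝓝 x] g) :
    Tendsto (fun n : ℕ => approx f n x - approx g n x) atTop (𝓝 0) := by
  obtain ⟨δ, hδ, h⟩ := exists_pull_mem hfg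
  have h0 : Negligible (Ioo 0 δ) fun v => pull (f - g) x v + pull (f - g) x (-v) := by
    refine (negligible_of_integrableOn_div measurableSet_Ioo
      (Ioo_subset_Ioo_right (by linarith [hδ.2])) (ψ := fun _ => 0) (by simp)).congr
      measurableSet_Ioo fun v hv => ?_
    have e1 := (h v hv).1
    have e2 := (h v hv).2
    simp only [mem_ofPred_eq] at e1 e2
    simp only [pull, Pi.sub_apply, e1, e2, sub_self, add_zero]
  exact (tendsto_approx_zero (hf.sub hg) hx ⟨hδ.1, hδ.2.le⟩ h0).congr (approx_sub hf hg hx)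

theorem tendsto_approx_iff {f g : ℝ → ℝ} (hf : Admissible f) (hg : Admissible g) {x : ℝ}
    (hx : 0 < x) (hfg : f =ᶠ[𝓝 x] g) (c : ℝ) :
    Tendsto (fun n : ℕ => approx f n x) atTop (𝓝 c) ↔
      Tendsto (fun n : ℕ => approx g n x) atTop (𝓝 c) := by
  have h := tendsto_approx_sub_of_eventuallyEq hf hg hx hfg
  refine ⟨fun hc => ?_, fun hc => ?_⟩
  · simpa using hc.sub h
  · simpa using h.add hc

end GaverStehfest

theorem theorem1 (f : ℝ → ℝ) (hf : GaverStehfest.Admissible f) (x : ℝ) (hx : 0 < x) :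
    -- (i) convergence at `x`, and the limit, depend only on `f` near `x`
    (∀ g : ℝ → ℝ, GaverStehfest.Admissible g → f =ᶠ[𝓝 x] g →
      ∀ c : ℝ, Tendsto (fun n : ℕ => GaverStehfest.approx f n x) atTop (𝓝 c) ↔
        Tendsto (fun n : ℕ => GaverStehfest.approx g n x) atTop (𝓝 c)) ∧
    -- (ii) the Dini-type criterion
    (∀ c ε : ℝ, ε ∈ Ioo (0 : ℝ) (1 / 4) →
      IntegrableOn (fun v : ℝ => |f (-x * Real.logb 2 (1 / 2 + v)) +
        f (-x * Real.logb 2 (1 / 2 - v)) - 2 * c| * v⁻¹) (Ioo 0 ε) →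
      Tendsto (fun n : ℕ => GaverStehfest.approx f n x) atTop (𝓝 c)) ∧
    -- (iii) the Jordan-type criterion
    (∀ U ∈ 𝓝 x, BoundedVariationOn f U →
      ∃ l r : ℝ, Tendsto f (𝓝[<] x) (𝓝 l) ∧ Tendsto f (𝓝[>] x) (𝓝 r) ∧
        Tendsto (fun n : ℕ => GaverStehfest.approx f n x) atTop (𝓝 ((r + l) / 2))) :=
  ⟨fun _ hg hfg c => GaverStehfest.tendsto_approx_iff hf hg hx hfg c,
    fun _ _ hε h => GaverStehfest.tendsto_approx_of_integrableOn hf hx hε h,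
    fun _ hU h => GaverStehfest.tendsto_approx_of_boundedVariationOn hf hx hU h⟩
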